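/- Paging with $n$ pages and a cache of size $k$, $1\le k\le n$, is the following metrical task system. A state is a set $C$ of exactly $k$ pages; moving between states $C$ and $C'$ costs $d(C,C')=|C\setminus C'|$; serving a request for page $i$ in state $C$ costs $\ell_i(C)=0$ if $i\in C$ and $\ell_i(C)=2$ if $i\notin C$. The horizon $T$ is known in advance and the request sequence $i_1,\dots,i_T$ is fixed by an oblivious adversary. At time $t$ a randomized online algorithm sees $i_t$ and then chooses a state $C_t$, depending on $i_1,\dots,i_t$ and on its internal randomness. Running time is not restricted. Theorem. There is an absolute constant $c>0$ such that for all $1\le k\le n$ there is a randomized online paging algorithm (that is, one algorithm for every horizon $T$) with the following two properties. (1) Its competitive ratio is $2H_k$, where $H_k=\sum_{j=1}^k\frac1j$: there is a constant $\beta>0$, independent of $T$, such that for every $T$ and every request sequence, $$\mathbb{E}\Big[\sum_{t=1}^T\ell_{i_t}(C_t)+\sum_{t=2}^Td(C_t,C_{t-1})\Big]\le 2H_k\min_{C^*_1,\dots,C^*_T}\Big(\sum_{t=1}^T\ell_{i_t}(C^*_t)+\sum_{t=2}^Td(C^*_t,C^*_{t-1})\Big)+\beta .$$ (2) For every $T\ge1$,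 every interval $I=\{t_0+1,\dots,t_0+m\}\subseteq\{1,\dots,T\}$ with $m\ge 1$, and every request sequence, $$\mathbb{E}\Big[\sum_{t\in I}\ell_{i_t}(C_t)+\sum_{t\in I\setminus\{t_0+1\}}d(C_t,C_{t-1})\Big]\le \min_{C}\sum_{t\in I}\ell_{i_t}(C)+c\Big(k\sqrt{|I|\log T}+\sqrt{k|I|\log\big(\tbinom nkT\big)}\Big),$$ and moreover $$k\sqrt{|I|\log T}+\sqrt{k|I|\log\big(\tbinom nkT\big)}\le c\,k\sqrt{|I|\log(nT)},$$ so the regret on $I$ is $O\big(k\sqrt{|I|\log(nT)}\big)$. -/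

import Mathlib

open MeasureTheory

/-- States of the paging system: the full caches, i.e. the `k`-subsets of the `n` pages. -/
abbrev Cache (n k : ℕ) : Type := {C : Finset (Fin n) // C.card = k}

namespace Paging

/-- Cost of moving between two caches: the number of pages that have to be fetched.
As both caches have `k` pages, this is symmetric. -/
def moveCost {n k : ℕ} (C C' : Cache n k) : ℝ := ((C.1 \ C'.1).card : ℝ)

/-- Cost of serving a request for page `i` while being in cache `C`: nothing on a hit, and two on
a miss (fetch `i` in place of some page of `C`, then fetch that page back). -/
def missLoss {n k : ℕ} (i : Fin n) (C : Cache n k) : ℝ := if i ∈ C.1 then 0 else 2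

/-- Total cost, on the time interval `{t₀ + 1, …, t₀ + m}`, of being in cache `S t` at time `t`,
when page `r t` is requested at time `t`. The move into the first cache of the interval is
not charged. -/
def cost {n k : ℕ} (r : ℕ → Fin n) (S : ℕ → Cache n k) (t₀ m : ℕ) : ℝ :=
  ∑ t ∈ Finset.Icc (t₀ + 1) (t₀ + m), missLoss (r t) (S t) +
    ∑ t ∈ Finset.Icc (t₀ + 2) (t₀ + m), moveCost (S t) (S (t - 1))

/-- The list `[r 1, …, r t]` of the requests revealed up to and including time `t`. -/
def history {n : ℕ} (r : ℕ → Fin n) (t : ℕ) : List (Fin n) :=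
  (List.range t).map fun s => r (s + 1)

/-- A randomized online paging algorithm: a random (with internal randomness `ω`) map that assigns
to the list of all requests seen so far, including the current one, the cache used now. -/
structure Algorithm (n k : ℕ) where
  Ω : Type
  [mΩ : MeasurableSpace Ω]
  μ : Measure Ω
  [isProb : IsProbabilityMeasure μ]
  act : List (Fin n) → Ω → Cache n k
  measurable_act : ∀ (h : List (Fin n)) (C : Cache n k), MeasurableSet {ω | act h ω = C}

attribute [instance] Algorithm.mΩ Algorithm.isProb

/-- The caches used by the algorithm when run on the request sequence `r` with randomness `ω`. -/
def Algorithm.run {n k : ℕ} (A : Algorithm n k) (r : ℕ → Fin n) (ω : A.Ω) (t : ℕ) : Cache n k :=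
  A.act (history r t) ω

/-- Expected cost of the algorithm on `{t₀ + 1, …, t₀ + m}`, for a fixed (oblivious) request
sequence `r`. -/
noncomputable def Algorithm.expectedCost {n k : ℕ} (A : Algorithm n k) (r : ℕ → Fin n)
    (t₀ m : ℕ) : ℝ :=
  ∫ ω, cost r (A.run r ω) t₀ m ∂A.μ

/-- A family of algorithms, one for every time horizon `T` (known in advance), has competitive
ratio `α`: up to an additive constant independent of `T`, the expected cost is at most `α` times
that of every offline sequence of caches. -/
def HasCompetitiveRatio {n k : ℕ} (A : ℕ → Algorithm n k) (α : ℝ) : Prop :=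
  ∃ β : ℝ, 0 < β ∧ ∀ (T : ℕ) (r : ℕ → Fin n) (S : ℕ → Cache n k),
    (A T).expectedCost r 0 T ≤ α * cost r S 0 T + β

/-- The algorithm has regret at most `R` on the interval `{t₀ + 1, …, t₀ + m}`: for every request
sequence, it is compared to the best fixed cache on that interval. -/
def Algorithm.HasRegretBound {n k : ℕ} (A : Algorithm n k) (t₀ m : ℕ) (R : ℝ) : Prop :=
  ∀ (r : ℕ → Fin n) (C : Cache n k),
    A.expectedCost r t₀ m ≤ ∑ t ∈ Finset.Icc (t₀ + 1) (t₀ + m), missLoss (r t) C + R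

end Paging

/-! The marking algorithm is made adaptive without spoiling its competitive ratio: it serves as the
default expert, and experts with small regret on dyadic blocks are added one scale at a time, each
with a tiny initial weight.

For one scale, multiplicative weights over all caches are restarted after every block. Optimal
coupling of successive laws turns them into an actual algorithm whose expected movement is at most
`k` times the decrease in probability mass. Within a block this decrease is at most `η` times the
expected loss, so moving costs only a factor `1 + k * η` (`exists_mw`, `exists_block_expert`).

Two algorithms `A` and `B` are combined by following `B` with probability `v / (1 + v)`, where the
weight `v` restarts at `Z` on every block and grows with the gain of `B` over `A`. The potential
`log (1 + v) / η` starts at almost `0` and is nonnegative, so the combination loses almost nothing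
against `A`; over a full block it gains like `B` up to `log (1 / Z) / η` and a term linear in `η`
(`exists_combination`). With `Z = T⁻⁴` the loss against `A` is at most `12 * k / T ^ 2` on any
window of length at most `T` that starts at a block boundary.

Scales are added from coarse to fine (`exists_chain`). A coarse block starts at a boundary of every
finer scale, so later combinations preserve its regret bound; the whole horizon starts at time `0`,
so the total cost exceeds that of marking by at most `12 * k`, independently of `T`. An arbitrary
interval splits into dyadic blocks of geometrically varying lengths, and the square roots sum to a
constant times the square root of its length (`sum_Ioc_le_of_dyadic`).

Marking is `2 H_k`-competitive because its expected faults are at most `H_k` times the number of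
clean requests, by a potential argument (`faultProb_add_potential_le`), and clean requests number at
most twice the offline cost plus `k` (`cleanCount_le`). -/

namespace Paging

/-! ### Elementary bounds, nonanticipating quantities and step costs. -/

variable {n k : ℕ}

lemma moveCost_nonneg (C C' : Cache n k) : 0 ≤ moveCost C C' := Nat.cast_nonneg _

lemma moveCost_le (C C' : Cache n k) : moveCost C C' ≤ k := by
  unfold moveCost
  exact_mod_cast (Finset.card_le_card Finset.sdiff_subset).trans C.2.le

lemma moveCost_self (C : Cache n k) : moveCost C C = 0 := by simp [moveCost]

lemma missLoss_nonneg (i : Fin n) (C : Cache n k) : 0 ≤ missLoss i C := by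
  unfold missLoss; split_ifs <;> norm_num

lemma missLoss_le (i : Fin n) (C : Cache n k) : missLoss i C ≤ 2 := by
  unfold missLoss; split_ifs <;> norm_num

lemma history_length (r : ℕ → Fin n) (t : ℕ) : (history r t).length = t := by
  simp [history]

lemma history_congr {r r' : ℕ → Fin n} {t : ℕ} (h : ∀ s, 1 ≤ s → s ≤ t → r s = r' s) :
    history r t = history r' t := by
  unfold history
  refine List.map_congr_left fun s hs => ?_
  rw [List.mem_range] at hs
  exact h _ (by omega) (by omega)

/-- A request sequence with a given initial segment. -/
def ofList [NeZero n] (h : List (Fin n)) (t : ℕ) : Fin n := h.getD (t - 1) 0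

lemma ofList_history [NeZero n] (r : ℕ → Fin n) {t s : ℕ} (h1 : 1 ≤ s) (h2 : s ≤ t) :
    ofList (history r t) s = r s := by
  have h3 : s - 1 < t := by omega
  simp [ofList, history, List.getD_eq_getElem?_getD, h3, Nat.sub_add_cancel h1]

/-- A quantity that, at time `t`, depends only on the requests revealed up to time `t`. -/
def Nonanticipating {α : Type*} (F : (ℕ → Fin n) → ℕ → α) : Prop :=
  ∀ (r r' : ℕ → Fin n) (t : ℕ), (∀ s, 1 ≤ s → s ≤ t → r s = r' s) → F r t = F r' t

/-- A nonanticipating quantity as a function of the list of revealed requests. -/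
def onList {α : Type*} [NeZero n] (F : (ℕ → Fin n) → ℕ → α) (h : List (Fin n)) : α :=
  F (ofList h) h.length

lemma Nonanticipating.onList_history {α : Type*} [NeZero n] {F : (ℕ → Fin n) → ℕ → α}
    (hF : Nonanticipating F) (r : ℕ → Fin n) (t : ℕ) : onList F (history r t) = F r t := by
  unfold onList
  rw [history_length]
  exact hF _ _ _ fun s h1 h2 => ofList_history r h1 h2

lemma Algorithm.integrable_pair (A : Algorithm n k) (f : Cache n k → Cache n k → ℝ)
    (h h' : List (Fin n)) : Integrable (fun ω => f (A.act h ω) (A.act h' ω)) A.μ := by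
  let _ : MeasurableSpace (Cache n k) := ⊤
  have hm : ∀ h, Measurable (A.act h) := fun h =>
    measurable_to_countable' fun C => A.measurable_act h C
  have hf : Measurable (fun q : Cache n k × Cache n k => f q.1 q.2) := measurable_of_finite _
  have hmeas : Measurable (fun ω => f (A.act h ω) (A.act h' ω)) :=
    hf.comp ((hm h).prodMk (hm h'))
  refine Integrable.of_bound hmeas.aestronglyMeasurable
    (∑ q : Cache n k × Cache n k, |f q.1 q.2|) (Filter.Eventually.of_forall fun ω => ?_)
  exact Finset.single_le_sum (f := fun q : Cache n k × Cache n k => |f q.1 q.2|)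
    (fun _ _ => abs_nonneg _) (Finset.mem_univ (A.act h ω, A.act h' ω))

lemma Algorithm.integrable_act (A : Algorithm n k) (f : Cache n k → ℝ) (h : List (Fin n)) :
    Integrable (fun ω => f (A.act h ω)) A.μ :=
  A.integrable_pair (fun C _ => f C) h h

/-- The expected cost of serving the request at time `t` and of the next move. -/
noncomputable def Algorithm.stepCost (A : Algorithm n k) (r : ℕ → Fin n) (t : ℕ) : ℝ :=
  ∫ ω, (missLoss (r t) (A.run r ω t) + moveCost (A.run r ω (t + 1)) (A.run r ω t)) ∂A.μ

lemma Algorithm.integrable_step (A : Algorithm n k) (r : ℕ → Fin n) (t : ℕ) :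
    Integrable (fun ω => missLoss (r t) (A.run r ω t) +
      moveCost (A.run r ω (t + 1)) (A.run r ω t)) A.μ :=
  A.integrable_pair (fun C C' => missLoss (r t) C + moveCost C' C) _ _

lemma Algorithm.stepCost_nonneg (A : Algorithm n k) (r : ℕ → Fin n) (t : ℕ) :
    0 ≤ A.stepCost r t :=
  integral_nonneg fun _ => add_nonneg (missLoss_nonneg _ _) (moveCost_nonneg _ _)

lemma Algorithm.stepCost_le (A : Algorithm n k) (r : ℕ → Fin n) (t : ℕ) :
    A.stepCost r t ≤ 2 + k := by
  have := integral_mono (A.integrable_step r t) (integrable_const (2 + k : ℝ))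
    fun ω => add_le_add (missLoss_le _ _) (moveCost_le _ _)
  simpa [Algorithm.stepCost] using this

/-- The step cost at `t` contains the move into the cache of time `t + 1`, so it is known once
request `t + 1` is revealed. That is just in time for weights used at time `t + 1`. -/
lemma Algorithm.stepCost_congr (A : Algorithm n k) {r r' : ℕ → Fin n} {t : ℕ} (ht : 1 ≤ t)
    (h : ∀ s, 1 ≤ s → s ≤ t + 1 → r s = r' s) : A.stepCost r t = A.stepCost r' t := by
  unfold Algorithm.stepCost Algorithm.run
  rw [history_congr h, history_congr (t := t) fun s h1 h2 => h s h1 (by omega),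
    h t ht (by omega)]

lemma cost_succ_eq (r : ℕ → Fin n) (S : ℕ → Cache n k) (t₀ m : ℕ) :
    cost r S t₀ (m + 1) = ∑ t ∈ Finset.Ioc t₀ (t₀ + m),
      (missLoss (r t) (S t) + moveCost (S (t + 1)) (S t)) +
      missLoss (r (t₀ + m + 1)) (S (t₀ + m + 1)) := by
  induction m with
  | zero => simp [cost]
  | succ m ih =>
    have h1 : cost r S t₀ (m + 1 + 1) = cost r S t₀ (m + 1) +
        missLoss (r (t₀ + (m + 1) + 1)) (S (t₀ + (m + 1) + 1)) +
        moveCost (S (t₀ + (m + 1) + 1)) (S (t₀ + (m + 1))) := by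
      unfold cost
      rw [show t₀ + (m + 1 + 1) = t₀ + (m + 1) + 1 by ring,
        Finset.sum_Icc_succ_top (by omega), Finset.sum_Icc_succ_top (by omega)]
      simp only [Nat.add_sub_cancel]
      ring
    rw [h1, ih, show t₀ + (m + 1) = t₀ + m + 1 by ring, Finset.sum_Ioc_succ_top (by omega)]
    ring

lemma cost_le_sum (r : ℕ → Fin n) (S : ℕ → Cache n k) (t₀ m : ℕ) :
    cost r S t₀ m ≤ ∑ t ∈ Finset.Ioc t₀ (t₀ + m),
      (missLoss (r t) (S t) + moveCost (S (t + 1)) (S t)) := by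
  cases m with
  | zero => simp [cost]
  | succ m =>
    rw [cost_succ_eq, ← add_assoc, Finset.sum_Ioc_succ_top (by omega)]
    linarith [moveCost_nonneg (S (t₀ + m + 1 + 1)) (S (t₀ + m + 1))]

/-- Charging each move to its earlier endpoint makes costs additive over adjacent intervals, at the
price of one surplus move at the end. -/
lemma Algorithm.expectedCost_le (A : Algorithm n k) (r : ℕ → Fin n) (t₀ m : ℕ) :
    A.expectedCost r t₀ m ≤ ∑ t ∈ Finset.Ioc t₀ (t₀ + m), A.stepCost r t := by
  unfold Algorithm.expectedCost Algorithm.stepCost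
  rw [← integral_finsetSum _ fun t _ => A.integrable_step r t]
  refine integral_mono ?_ (integrable_finsetSum _ fun t _ => A.integrable_step r t)
    fun ω => cost_le_sum r _ t₀ m
  unfold cost
  refine Integrable.add (integrable_finsetSum _ fun t _ => ?_)
    (integrable_finsetSum _ fun t _ => ?_)
  · exact A.integrable_act (fun C => missLoss (r t) C) _
  · exact A.integrable_pair (fun C C' => moveCost C C') _ _

/-! ### Mixing two algorithms with a random threshold. -/

/-- The uniform distribution on `[0, 1)`. -/
noncomputable def uniform01 : Measure ℝ := volume.restrict (Set.Ico 0 1)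

instance : IsProbabilityMeasure uniform01 := ⟨by simp [uniform01]⟩

lemma uniform01_real_Iio {p : ℝ} (h0 : 0 ≤ p) (h1 : p ≤ 1) : uniform01.real (Set.Iio p) = p := by
  rw [uniform01, Measure.real, Measure.restrict_apply measurableSet_Iio,
    show Set.Iio p ∩ Set.Ico 0 1 = Set.Ico 0 p by
      ext x; simp only [Set.mem_inter_iff, Set.mem_Iio, Set.mem_Ico]
      constructor
      · rintro ⟨a, b, c⟩; exact ⟨b, a⟩
      · rintro ⟨a, b⟩; exact ⟨b, a, b.trans_le h1⟩]
  simp [h0]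

/-- Follow `B` if a uniformly random threshold is below `p`, and `A` otherwise. -/
noncomputable def mix [NeZero n] (A B : Algorithm n k) (p : (ℕ → Fin n) → ℕ → ℝ) :
    Algorithm n k where
  Ω := A.Ω × B.Ω × ℝ
  μ := A.μ.prod (B.μ.prod uniform01)
  act h ω := if ω.2.2 < onList p h then B.act h ω.2.1 else A.act h ω.1
  measurable_act h C := by
    have h1 : MeasurableSet {ω : A.Ω × B.Ω × ℝ | ω.2.2 < onList p h} :=
      measurableSet_lt (by fun_prop) measurable_const
    have h2 : MeasurableSet {ω : A.Ω × B.Ω × ℝ | B.act h ω.2.1 = C} :=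
      (measurable_fst.comp measurable_snd) (B.measurable_act h C)
    have h3 : MeasurableSet {ω : A.Ω × B.Ω × ℝ | A.act h ω.1 = C} :=
      measurable_fst (A.measurable_act h C)
    convert (h1.inter h2).union (h1.compl.inter h3) using 1
    ext ω
    by_cases hω : ω.2.2 < onList p h <;> simp [hω]

/-- The same threshold is used at all times, so a switch between `A` and `B` occurs only when it
lies between the two successive probabilities, and a switch costs at most `k`. -/
lemma stepCost_mix_le [NeZero n] (A B : Algorithm n k) {p : (ℕ → Fin n) → ℕ → ℝ}
    (hp : Nonanticipating p) (h0 : ∀ r t, 0 ≤ p r t) (h1 : ∀ r t, p r t ≤ 1)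
    (r : ℕ → Fin n) (t : ℕ) :
    (mix A B p).stepCost r t ≤ (1 - p r t) * A.stepCost r t + p r t * B.stepCost r t +
      k * |p r (t + 1) - p r t| := by
  set f : A.Ω → ℝ := fun ω =>
    missLoss (r t) (A.run r ω t) + moveCost (A.run r ω (t + 1)) (A.run r ω t) with hf
  set g : B.Ω → ℝ := fun ω =>
    missLoss (r t) (B.run r ω t) + moveCost (B.run r ω (t + 1)) (B.run r ω t) with hg
  set a := p r t
  set b := p r (t + 1)
  let χ : ℝ → ℝ := (Set.Iio a).indicator 1
  let χ' : ℝ → ℝ := (Set.Iio a)ᶜ.indicator 1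
  let D : Set ℝ := Set.Iio (max a b) \ Set.Iio (min a b)
  let ψ : ℝ → ℝ := D.indicator 1
  have hD : MeasurableSet D := measurableSet_Iio.diff measurableSet_Iio
  have iχ : Integrable χ uniform01 := (integrable_const 1).indicator measurableSet_Iio
  have iχ' : Integrable χ' uniform01 := (integrable_const 1).indicator measurableSet_Iio.compl
  have iψ : Integrable ψ uniform01 := (integrable_const 1).indicator hD
  have if' : Integrable f A.μ := A.integrable_step r t
  have ig : Integrable g B.μ := B.integrable_step r t
  have e1 : ∫ u, χ u ∂uniform01 = a := by
    rw [integral_indicator_one measurableSet_Iio, uniform01_real_Iio (h0 _ _) (h1 _ _)]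
  have e2 : ∫ u, χ' u ∂uniform01 = 1 - a := by
    rw [integral_indicator_one measurableSet_Iio.compl, measureReal_compl measurableSet_Iio,
      uniform01_real_Iio (h0 _ _) (h1 _ _)]
    simp [a]
  have e3 : ∫ u, ψ u ∂uniform01 = |b - a| := by
    rw [integral_indicator_one hD, measureReal_sdiff (Set.Iio_subset_Iio min_le_max)
      measurableSet_Iio, uniform01_real_Iio (le_max_of_le_left (h0 _ _))
      (max_le (h1 _ _) (h1 _ _)), uniform01_real_Iio (le_min (h0 _ _) (h0 _ _))
      (min_le_of_left_le (h1 _ _)), max_sub_min_eq_abs]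
  have iF : Integrable (fun ω : A.Ω × B.Ω × ℝ => f ω.1 * (1 * χ' ω.2.2))
      (A.μ.prod (B.μ.prod uniform01)) :=
    if'.mul_prod ((integrable_const (1 : ℝ)).mul_prod iχ')
  have iG : Integrable (fun ω : A.Ω × B.Ω × ℝ => 1 * (g ω.2.1 * χ ω.2.2))
      (A.μ.prod (B.μ.prod uniform01)) :=
    (integrable_const (1 : ℝ)).mul_prod (ig.mul_prod iχ)
  have iH : Integrable (fun ω : A.Ω × B.Ω × ℝ => (k : ℝ) * (1 * ψ ω.2.2))
      (A.μ.prod (B.μ.prod uniform01)) :=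
    (integrable_const (k : ℝ)).mul_prod ((integrable_const (1 : ℝ)).mul_prod iψ)
  calc (mix A B p).stepCost r t
      ≤ ∫ ω : A.Ω × B.Ω × ℝ, (f ω.1 * (1 * χ' ω.2.2) + 1 * (g ω.2.1 * χ ω.2.2) +
          k * (1 * ψ ω.2.2)) ∂(A.μ.prod (B.μ.prod uniform01)) := by
        refine integral_mono ((mix A B p).integrable_step r t) ((iF.add iG).add iH) ?_
        rintro ⟨x, y, u⟩
        have hx : ∀ s, (mix A B p).run r (x, y, u) s =
            if u < p r s then B.run r y s else A.run r x s := by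
          intro s
          simp only [Algorithm.run, mix, hp.onList_history]
        have hfx : f x = missLoss (r t) (A.run r x t) +
          moveCost (A.run r x (t + 1)) (A.run r x t) := rfl
        have hgy : g y = missLoss (r t) (B.run r y t) +
          moveCost (B.run r y (t + 1)) (B.run r y t) := rfl
        have m1 := moveCost_le (B.run r y (t + 1)) (A.run r x t)
        have m2 := moveCost_le (A.run r x (t + 1)) (B.run r y t)
        have m3 := moveCost_nonneg (B.run r y (t + 1)) (B.run r y t)
        have m4 := moveCost_nonneg (A.run r x (t + 1)) (A.run r x t)
        simp only [hx, hfx, hgy]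
        by_cases ua : u < p r t <;> by_cases ub : u < p r (t + 1)
        · have : u ∉ D := fun h => h.2 (lt_min ua ub)
          simp [χ, χ', ψ, ua, ub, a, this]
        · have : u ∈ D := ⟨lt_max_of_lt_left ua, fun h => ub (lt_min_iff.1 h).2⟩
          simp [χ, χ', ψ, ua, ub, a, this]
          linarith
        · have : u ∈ D := ⟨lt_max_of_lt_right ub, fun h => ua (lt_min_iff.1 h).1⟩
          simp [χ, χ', ψ, ua, ub, a, this, not_lt.1 ua]
          linarith
        · have : u ∉ D := fun h => (lt_max_iff.1 h.1).elim ua ub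
          simp [χ, χ', ψ, ua, ub, a, this, not_lt.1 ua]
    _ = (1 - a) * A.stepCost r t + a * B.stepCost r t + k * |b - a| := by
        rw [integral_add (f := fun ω : A.Ω × B.Ω × ℝ => f ω.1 * (1 * χ' ω.2.2) +
            1 * (g ω.2.1 * χ ω.2.2)) (iF.add iG) iH, integral_add iF iG,
          integral_prod_mul f (fun y : B.Ω × ℝ => 1 * χ' y.2),
          integral_prod_mul (fun _ : A.Ω => (1 : ℝ)) (fun y : B.Ω × ℝ => g y.1 * χ y.2),
          integral_prod_mul (fun _ : A.Ω => (k : ℝ)) (fun y : B.Ω × ℝ => 1 * ψ y.2),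
          integral_prod_mul g χ, integral_prod_mul (fun _ : B.Ω => (1 : ℝ)) χ',
          integral_prod_mul (fun _ : B.Ω => (1 : ℝ)) ψ, e1, e2, e3]
        simp [Algorithm.stepCost, f, g]
        ring


/-! ### Realizing a sequence of laws by optimal couplings. -/

lemma uniform01_real_Ico_le {s t : ℝ} (h : s ≤ t) : uniform01.real (Set.Ico s t) ≤ t - s := by
  have h1 : uniform01 (Set.Ico s t) ≤ volume (Set.Ico s t) := Measure.restrict_le_self _
  rw [Real.volume_Ico] at h1
  exact ENNReal.toReal_le_of_le_ofReal (by linarith) h1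

/-- The uniform law has no atoms: the mass of `A` below `s` is continuous in `s`, and the
intermediate value theorem applies. -/
lemma exists_subset_uniform01_real_eq {A : Set ℝ} (hA : MeasurableSet A) {x : ℝ} (h0 : 0 ≤ x)
    (h1 : x ≤ uniform01.real A) : ∃ B ⊆ A, MeasurableSet B ∧ uniform01.real B = x := by
  let F : ℝ → ℝ := fun s => uniform01.real (A ∩ Set.Iio s)
  have hmono : Monotone F := fun s t h =>
    measureReal_mono (Set.inter_subset_inter_right _ (Set.Iio_subset_Iio h))
  have hlip : ∀ s t, s ≤ t → F t ≤ F s + (t - s) := by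
    intro s t h
    have h2 : A ∩ Set.Iio t ⊆ (A ∩ Set.Iio s) ∪ Set.Ico s t := by
      rintro u ⟨hu, ht⟩
      rcases lt_or_ge u s with hs | hs
      · exact Or.inl ⟨hu, hs⟩
      · exact Or.inr ⟨hs, ht⟩
    calc F t ≤ uniform01.real ((A ∩ Set.Iio s) ∪ Set.Ico s t) := measureReal_mono h2
      _ ≤ F s + uniform01.real (Set.Ico s t) := measureReal_union_le _ _
      _ ≤ F s + (t - s) := by linarith [uniform01_real_Ico_le h]
  have hcont : Continuous F := by
    refine (LipschitzWith.of_dist_le_mul (K := 1) fun s t => ?_).continuous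
    rw [NNReal.coe_one, one_mul, Real.dist_eq, Real.dist_eq]
    rcases le_total s t with h | h
    · rw [abs_sub_comm, abs_sub_comm s t, abs_of_nonneg (sub_nonneg.2 (hmono h)),
        abs_of_nonneg (sub_nonneg.2 h)]
      linarith [hlip s t h]
    · rw [abs_of_nonneg (sub_nonneg.2 (hmono h)), abs_of_nonneg (sub_nonneg.2 h)]
      linarith [hlip t s h]
  have hF0 : F 0 = 0 := by
    have : uniform01.real (A ∩ Set.Iio 0) ≤ uniform01.real (Set.Iio 0) :=
      measureReal_mono Set.inter_subset_right
    rw [uniform01_real_Iio le_rfl zero_le_one] at this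
    exact le_antisymm this measureReal_nonneg
  have hF1 : F 1 = uniform01.real A := by
    have h3 : uniform01.real (Set.Iio 1)ᶜ = 0 := by
      rw [measureReal_compl measurableSet_Iio, uniform01_real_Iio zero_le_one le_rfl]; simp
    have h4 : A ⊆ (A ∩ Set.Iio 1) ∪ (Set.Iio 1)ᶜ := by
      intro u hu
      by_cases h : u < 1
      · exact Or.inl ⟨hu, h⟩
      · exact Or.inr h
    have h5 := (measureReal_mono (μ := uniform01) h4).trans (measureReal_union_le _ _)
    rw [h3, add_zero] at h5
    exact le_antisymm (measureReal_mono Set.inter_subset_left) h5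
  obtain ⟨s, -, hs⟩ := intermediate_value_Icc zero_le_one hcont.continuousOn
    (show x ∈ Set.Icc (F 0) (F 1) by rw [hF0, hF1]; exact ⟨h0, h1⟩)
  exact ⟨_, Set.inter_subset_left, hA.inter measurableSet_Iio, hs⟩

lemma exists_measurable_split {ι : Type*} {s : Finset ι} (hs : s.Nonempty) {x : ι → ℝ}
    (h0 : ∀ i, 0 ≤ x i) {A : Set ℝ} (hA : MeasurableSet A)
    (hx : ∑ i ∈ s, x i = uniform01.real A) :
    ∃ g : ℝ → ι, (∀ u, g u ∈ s) ∧ (∀ i, MeasurableSet {u | g u = i}) ∧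
      ∀ i ∈ s, uniform01.real (A ∩ {u | g u = i}) = x i := by
  classical
  induction hs using Finset.Nonempty.cons_induction generalizing A with
  | singleton a =>
    refine ⟨fun _ => a, by simp, fun i => by simp, fun i hi => ?_⟩
    rw [Finset.mem_singleton] at hi
    subst hi
    simpa using hx.symm
  | cons a s ha hs ih =>
    rw [Finset.sum_cons] at hx
    obtain ⟨B, hBA, hB, hBx⟩ := exists_subset_uniform01_real_eq hA (h0 a)
      (by linarith [Finset.sum_nonneg fun i (_ : i ∈ s) => h0 i])
    obtain ⟨g, hg, hgm, hgx⟩ := ih (hA.diff hB)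
      (by rw [measureReal_sdiff hBA hB]; linarith)
    refine ⟨fun u => if u ∈ B then a else g u, fun u => ?_, fun i => ?_, fun i hi => ?_⟩
    · by_cases h : u ∈ B <;> simp [h, hg]
    · have : {u | (if u ∈ B then a else g u) = i} =
          (B ∩ {_u | a = i}) ∪ (Bᶜ ∩ {u | g u = i}) := by
        ext u; by_cases h : u ∈ B <;> simp [h]
      rw [this]
      exact (hB.inter (MeasurableSet.const _)).union (hB.compl.inter (hgm i))
    · rcases Finset.mem_cons.1 hi with rfl | hi
      · rw [← hBx]
        congr 1
        ext u
        by_cases h : u ∈ B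
        · simp [h, hBA h]
        · simp only [Set.mem_inter_iff, Set.mem_ofPred_eq, h, if_false, iff_false]
          rintro ⟨_, h2⟩
          exact ha (h2 ▸ hg u)
      · rw [← hgx i hi]
        congr 1
        ext u
        by_cases h : u ∈ B
        · have : a ≠ i := fun h => ha (h ▸ hi)
          simp [h, this]
        · simp [h]

/-- Inside each `{f = i}` keep a piece of mass `min (p i) (q i)` where `g = f`, and split the
remaining set so as to fill the deficits of `q`. Disagreement is confined to that remaining set. -/
lemma exists_coupled {ι : Type*} [Fintype ι] [Nonempty ι] {f : ℝ → ι}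
    (hf : ∀ i, MeasurableSet {u | f u = i}) {q : ι → ℝ} (h0 : ∀ i, 0 ≤ q i) (h1 : ∑ i, q i = 1) :
    ∃ g : ℝ → ι, (∀ i, MeasurableSet {u | g u = i}) ∧
      (∀ i, uniform01.real {u | g u = i} = q i) ∧
      uniform01.real {u | f u ≠ g u} ≤
        ∑ i, max (uniform01.real {u | f u = i} - q i) 0 := by
  classical
  set p : ι → ℝ := fun i => uniform01.real {u | f u = i} with hp
  have hK : ∀ i, ∃ B ⊆ {u | f u = i}, MeasurableSet B ∧ uniform01.real B = min (p i) (q i) :=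
    fun i => exists_subset_uniform01_real_eq (hf i) (le_min measureReal_nonneg (h0 i))
      (min_le_left _ _)
  choose K hKf hKm hKr using hK
  have hdisj : Pairwise (Function.onFun Disjoint fun i => {u | f u = i}) := by
    intro i j hij
    rw [Function.onFun, Set.disjoint_left]
    intro u hi hj
    exact hij (hi.symm.trans hj)
  have hpsum : ∑ i, p i = 1 := by
    have := measureReal_biUnion_finset (μ := uniform01) (s := Finset.univ)
      (f := fun i => {u | f u = i}) (fun i _ j _ h => hdisj h) (fun i _ => hf i)
    rw [← this]
    have h2 : (⋃ i ∈ Finset.univ, {u | f u = i}) = Set.univ := by ext u; simp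
    rw [h2]; simp
  have hKdisj : Pairwise (Function.onFun Disjoint K) := fun i j hij =>
    (hdisj hij).mono (hKf i) (hKf j)
  have hKsum : uniform01.real (⋃ i ∈ Finset.univ, K i) = ∑ i, min (p i) (q i) := by
    rw [measureReal_biUnion_finset (fun i _ j _ h => hKdisj h) (fun i _ => hKm i)]
    exact Finset.sum_congr rfl fun i _ => hKr i
  have hUm : MeasurableSet (⋃ i ∈ Finset.univ, K i) :=
    Finset.measurableSet_biUnion _ fun i _ => hKm i
  set R := (⋃ i ∈ Finset.univ, K i)ᶜ with hR
  have hRr : uniform01.real R = 1 - ∑ i, min (p i) (q i) := by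
    rw [hR, measureReal_compl hUm, hKsum]; simp
  obtain ⟨g, -, hgm, hgx⟩ := exists_measurable_split (s := Finset.univ) Finset.univ_nonempty
    (x := fun i => q i - min (p i) (q i)) (fun i => sub_nonneg.2 (min_le_right _ _)) hUm.compl
    (by rw [Finset.sum_sub_distrib, h1, ← hRr])
  have hmem : ∀ u, u ∈ R ↔ u ∉ K (f u) := by
    intro u
    simp only [hR, Set.mem_compl_iff, Set.mem_iUnion, Finset.mem_univ, exists_prop, true_and,
      not_exists]
    exact ⟨fun h => h _, fun h i hi => h ((hKf i hi : f u = i) ▸ hi)⟩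
  have hset : ∀ i, {u | (if u ∈ R then g u else f u) = i} = K i ∪ (R ∩ {u | g u = i}) := by
    intro i
    ext u
    by_cases h : u ∈ R
    · have : u ∉ K i := fun hi => (hmem u).1 h ((hKf i hi : f u = i) ▸ hi)
      simp [h, this]
    · have h' : u ∈ K (f u) := by simpa using (hmem u).not.1 h
      simp only [Set.mem_ofPred_eq, h, if_false, Set.mem_union, Set.mem_inter_iff, false_and,
        or_false]
      exact ⟨fun hi => hi ▸ h', fun hi => hKf i hi⟩
  refine ⟨fun u => if u ∈ R then g u else f u, fun i => ?_, fun i => ?_, ?_⟩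
  · rw [hset]
    exact (hKm i).union (hUm.compl.inter (hgm i))
  · rw [hset, measureReal_union _ (hUm.compl.inter (hgm i)), hKr, hgx i (Finset.mem_univ i)]
    · ring
    · rw [Set.disjoint_left]
      rintro u hu ⟨h, -⟩
      exact (hmem u).1 h ((hKf i hu : f u = i) ▸ hu)
  · calc uniform01.real {u | f u ≠ if u ∈ R then g u else f u} ≤ uniform01.real R := by
          refine measureReal_mono fun u hu => ?_
          by_contra h
          exact hu (by simp [h])
      _ = ∑ i, (p i - min (p i) (q i)) := by rw [hRr, Finset.sum_sub_distrib, hpsum]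
      _ = ∑ i, max (p i - q i) 0 := by
          refine Finset.sum_congr rfl fun i _ => ?_
          rcases le_total (p i) (q i) with h | h
          · rw [min_eq_left h, max_eq_right (by linarith)]; ring
          · rw [min_eq_right h, max_eq_left (by linarith)]

open Classical in
/-- A random variable with law `q` that differs from `f` as rarely as possible. -/
noncomputable def recouple {ι : Type*} [Fintype ι] (f : ℝ → ι) (q : ι → ℝ) : ℝ → ι :=
  if h : ∃ g : ℝ → ι, (∀ i, MeasurableSet {u | g u = i}) ∧
      (∀ i, uniform01.real {u | g u = i} = q i) ∧
      uniform01.real {u | f u ≠ g u} ≤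
        ∑ i, max (uniform01.real {u | f u = i} - q i) 0
  then h.choose else f

lemma recouple_spec {ι : Type*} [Fintype ι] [Nonempty ι] {f : ℝ → ι}
    (hf : ∀ i, MeasurableSet {u | f u = i}) {q : ι → ℝ} (h0 : ∀ i, 0 ≤ q i) (h1 : ∑ i, q i = 1) :
    (∀ i, MeasurableSet {u | recouple f q u = i}) ∧
      (∀ i, uniform01.real {u | recouple f q u = i} = q i) ∧
      uniform01.real {u | f u ≠ recouple f q u} ≤
        ∑ i, max (uniform01.real {u | f u = i} - q i) 0 := by
  have h := exists_coupled hf h0 h1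
  rw [recouple, dif_pos h]
  exact h.choose_spec

/-- Successive optimal couplings of the laws `p r 0, p r 1, …`. -/
noncomputable def coupledPath {ι : Type*} [Fintype ι] [Nonempty ι]
    (p : (ℕ → Fin n) → ℕ → ι → ℝ) (r : ℕ → Fin n) : ℕ → ℝ → ι
  | 0 => recouple (fun _ => Classical.arbitrary ι) (p r 0)
  | t + 1 => recouple (coupledPath p r t) (p r (t + 1))

/-- The coupling is a fixed choice depending only on the previous variable and the new law, so no
future request enters. -/
lemma coupledPath_nonanticipating {ι : Type*} [Fintype ι] [Nonempty ι]
    {p : (ℕ → Fin n) → ℕ → ι → ℝ} (hp : Nonanticipating p) : Nonanticipating (coupledPath p) := by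
  intro r r' t h
  induction t with
  | zero => simp only [coupledPath]; rw [hp r r' 0 h]
  | succ t ih =>
    simp only [coupledPath]
    rw [hp r r' (t + 1) h, ih fun s h1 h2 => h s h1 (by omega)]

/-- A single uniform seed drives all times. The cache changes with probability at most the mass that
must be moved, and each change costs at most `k`. -/
lemma exists_algorithm_of_laws [NeZero n] [Nonempty (Cache n k)]
    {p : (ℕ → Fin n) → ℕ → Cache n k → ℝ} (hp : Nonanticipating p)
    (h0 : ∀ r t C, 0 ≤ p r t C) (h1 : ∀ r t, ∑ C, p r t C = 1) :
    ∃ A : Algorithm n k, ∀ r t,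
      A.stepCost r t ≤ ∑ C, p r t C * missLoss (r t) C +
        k * ∑ C, max (p r t C - p r (t + 1) C) 0 := by
  have hm : ∀ r t, (∀ C, MeasurableSet {u | coupledPath p r t u = C}) ∧
      ∀ C, uniform01.real {u | coupledPath p r t u = C} = p r t C := by
    intro r t
    induction t with
    | zero =>
      have := recouple_spec (f := fun _ => Classical.arbitrary (Cache n k))
        (fun i => MeasurableSet.const _) (h0 r 0) (h1 r 0)
      exact ⟨this.1, this.2.1⟩
    | succ t ih =>
      have := recouple_spec ih.1 (h0 r (t + 1)) (h1 r (t + 1))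
      exact ⟨this.1, this.2.1⟩
  let A : Algorithm n k :=
    { Ω := ℝ
      μ := uniform01
      act := onList (coupledPath p)
      measurable_act := fun h C => (hm _ _).1 C }
  refine ⟨A, fun r t => ?_⟩
  have hrun : ∀ s u, A.run r u s = coupledPath p r s u := fun s u =>
    congrFun ((coupledPath_nonanticipating hp).onList_history r s) u
  have hmove := (recouple_spec (hm r t).1 (h0 r (t + 1)) (h1 r (t + 1))).2.2
  simp only [(hm r t).2] at hmove
  change uniform01.real {u | coupledPath p r t u ≠ coupledPath p r (t + 1) u} ≤ _ at hmove
  have hDm : MeasurableSet {u | coupledPath p r t u ≠ coupledPath p r (t + 1) u} := by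
    have : {u | coupledPath p r t u ≠ coupledPath p r (t + 1) u} =
        (⋃ C, {u | coupledPath p r t u = C} ∩ {u | coupledPath p r (t + 1) u = C})ᶜ := by
      ext u; simp [eq_comm]
    rw [this]
    exact (MeasurableSet.iUnion fun C => ((hm r t).1 C).inter ((hm r (t + 1)).1 C)).compl
  set D := {u | coupledPath p r t u ≠ coupledPath p r (t + 1) u}
  have i1 : ∀ C, Integrable (fun u => missLoss (r t) C *
      ({u | coupledPath p r t u = C} : Set ℝ).indicator (1 : ℝ → ℝ) u) uniform01 := fun C =>
    ((integrable_const 1).indicator ((hm r t).1 C)).const_mul _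
  have i2 : Integrable (fun u => (k : ℝ) * D.indicator (1 : ℝ → ℝ) u) uniform01 :=
    ((integrable_const 1).indicator hDm).const_mul _
  calc A.stepCost r t ≤ ∫ u, (∑ C, missLoss (r t) C *
        ({u | coupledPath p r t u = C} : Set ℝ).indicator (1 : ℝ → ℝ) u +
        k * D.indicator (1 : ℝ → ℝ) u) ∂uniform01 := by
        refine integral_mono (A.integrable_step r t)
          ((integrable_finsetSum _ fun C _ => i1 C).add i2) fun u => ?_
        simp only [hrun]
        refine add_le_add ?_ ?_
        · rw [Finset.sum_eq_single (coupledPath p r t u)]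
          · simp
          · intro C _ hC
            simp [hC.symm]
          · simp
        · by_cases hu : u ∈ D
          · simpa [hu] using moveCost_le _ _
          · have hu' : coupledPath p r t u = coupledPath p r (t + 1) u := by
              by_contra h
              exact hu h
            simp [hu, hu', moveCost_self]
    _ = ∑ C, p r t C * missLoss (r t) C + k * uniform01.real D := by
        rw [integral_add (integrable_finsetSum _ fun C _ => i1 C) i2,
          integral_finsetSum _ fun C _ => i1 C, integral_const_mul, integral_indicator_one hDm]
        congr 1
        refine Finset.sum_congr rfl fun C _ => ?_
        rw [integral_const_mul, integral_indicator_one ((hm r t).1 C), (hm r t).2, mul_comm]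
    _ ≤ _ := by gcongr


/-! ### Multiplicative weights restarted on blocks. -/

/-- Multiplicative weights on the caches, restarted after every `τ` steps. -/
noncomputable def mwWeight (τ : ℕ) (η : ℝ) (r : ℕ → Fin n) : ℕ → Cache n k → ℝ
  | 0 => 1
  -- The restart takes effect at time `s * τ + 1`, so the blocks are `Ioc (s * τ) (s * τ + τ)`.
  | t + 1 => fun C => if τ ∣ t then 1 else mwWeight τ η r t C * (1 - η * missLoss (r t) C)

lemma mwWeight_nonanticipating (τ : ℕ) (η : ℝ) :
    Nonanticipating (mwWeight (n := n) (k := k) τ η) := by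
  intro r r' t h
  induction t with
  | zero => rfl
  | succ t ih =>
    funext C
    rcases Nat.eq_zero_or_pos t with rfl | ht
    · simp [mwWeight]
    · simp only [mwWeight]
      rw [ih fun s h1 h2 => h s h1 (by omega), h t ht (by omega)]

lemma mwWeight_pos (τ : ℕ) {η : ℝ} (h0 : 0 ≤ η) (h1 : η ≤ 1 / 4) (r : ℕ → Fin n) (t : ℕ)
    (C : Cache n k) : 0 < mwWeight τ η r t C := by
  induction t with
  | zero => simp [mwWeight]
  | succ t ih =>
    simp only [mwWeight]
    split_ifs
    · exact one_pos
    · have h2 := missLoss_le (r t) C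
      have h3 := missLoss_nonneg (r t) C
      exact mul_pos ih (by nlinarith)

/-- The distribution proportional to the weights. -/
noncomputable def mwLaw (τ : ℕ) (η : ℝ) (r : ℕ → Fin n) (t : ℕ) (C : Cache n k) : ℝ :=
  mwWeight τ η r t C / ∑ C' : Cache n k, mwWeight τ η r t C'

lemma exp_neg_le_one_sub {x : ℝ} (h0 : 0 ≤ x) (h1 : x ≤ 1 / 2) :
    Real.exp (-(x + x ^ 2)) ≤ 1 - x := by
  have h2 := Real.quadratic_le_exp_of_nonneg (show 0 ≤ x + x ^ 2 by positivity)
  rw [Real.exp_neg, inv_le_iff_one_le_mul₀ (Real.exp_pos _)]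
  refine le_trans ?_ (mul_le_mul_of_nonneg_left h2 (by linarith : 0 ≤ 1 - x))
  have h3 : 0 ≤ 1 - x - x ^ 2 - x ^ 3 := by nlinarith [mul_nonneg h0 h0]
  nlinarith [mul_nonneg (sq_nonneg x) h3]

/-- The weights `V` are those obtained without a restart at the end of the block; for `j = τ` they
differ from `mwWeight` at the next time, hence the existential. The total weight shrinks with the
expected loss, while `1 - x ≥ exp (-(x + x ^ 2))` and losses at most `2` bound each single weight
below. -/
lemma mw_potential [Nonempty (Cache n k)] {τ : ℕ} {η : ℝ} (h0 : 0 ≤ η) (h1 : η ≤ 1 / 4)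
    (r : ℕ → Fin n) (s j : ℕ) (hj : j ≤ τ) :
    ∃ V : Cache n k → ℝ, (j < τ → mwWeight τ η r (s * τ + j + 1) = V) ∧
      ∑ C, V C ≤ Fintype.card (Cache n k) * Real.exp (-(η * ∑ t ∈ Finset.Ioc (s * τ) (s * τ + j),
        ∑ C : Cache n k, mwLaw τ η r t C * missLoss (r t) C)) ∧
      ∀ C, Real.exp (-(η * (1 + 2 * η) *
        ∑ t ∈ Finset.Ioc (s * τ) (s * τ + j), missLoss (r t) C)) ≤ V C := by
  induction j with
  | zero =>
    refine ⟨1, fun _ => ?_, ?_, ?_⟩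
    · funext C; simp [mwWeight]
    · simp
    · simp
  | succ j ih =>
    obtain ⟨V, hV, hsum, hC⟩ := ih (by omega)
    replace hV := hV (by omega)
    set t := s * τ + j + 1 with ht
    refine ⟨fun C => V C * (1 - η * missLoss (r t) C), fun hj' => ?_, ?_, fun C => ?_⟩
    · funext C
      have hnd : ¬ τ ∣ t := by
        intro h
        rw [ht, add_assoc, Nat.dvd_add_right (Dvd.intro_left s rfl)] at h
        exact absurd (Nat.le_of_dvd (by omega) h) (by omega)
      rw [show s * τ + (j + 1) + 1 = t + 1 by omega]
      simp only [mwWeight, if_neg hnd, hV]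
    · have hW : 0 < ∑ C, V C := by
        rw [← hV]
        exact Finset.sum_pos (fun C _ => mwWeight_pos τ h0 h1 r _ C) Finset.univ_nonempty
      have hq : (∑ C, V C) * ∑ C : Cache n k, mwLaw τ η r t C * missLoss (r t) C =
          ∑ C, V C * missLoss (r t) C := by
        rw [Finset.mul_sum]
        refine Finset.sum_congr rfl fun C _ => ?_
        rw [mwLaw, hV]
        field_simp
      rw [← add_assoc, Finset.sum_Ioc_succ_top (by omega), ← ht, mul_add, neg_add, Real.exp_add,
        ← mul_assoc]
      calc ∑ C, V C * (1 - η * missLoss (r t) C)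
          = (∑ C, V C) * (1 - η * ∑ C : Cache n k, mwLaw τ η r t C * missLoss (r t) C) := by
            rw [mul_sub, mul_left_comm, hq, Finset.mul_sum, mul_one, ← Finset.sum_sub_distrib]
            exact Finset.sum_congr rfl fun C _ => by ring
        _ ≤ (∑ C, V C) * Real.exp (-(η * ∑ C : Cache n k, mwLaw τ η r t C * missLoss (r t) C)) := by
            refine mul_le_mul_of_nonneg_left ?_ hW.le
            linarith [Real.add_one_le_exp (-(η * ∑ C : Cache n k, mwLaw τ η r t C * missLoss (r t) C))]
        _ ≤ _ := mul_le_mul_of_nonneg_right hsum (Real.exp_pos _).le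
    · have h2 := missLoss_le (r t) C
      have h3 := missLoss_nonneg (r t) C
      rw [← add_assoc, Finset.sum_Ioc_succ_top (by omega), ← ht, mul_add, neg_add, Real.exp_add]
      refine mul_le_mul (hC C) ?_ (Real.exp_pos _).le ((Real.exp_pos _).le.trans (hC C))
      refine le_trans (Real.exp_le_exp.2 ?_) (exp_neg_le_one_sub (by positivity) (by nlinarith))
      have : η ^ 2 * missLoss (r t) C * missLoss (r t) C ≤ η ^ 2 * missLoss (r t) C * 2 :=
        mul_le_mul_of_nonneg_left h2 (by positivity)
      nlinarith [mul_nonneg (sq_nonneg η) h3]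

lemma mwLaw_nonneg (τ : ℕ) {η : ℝ} (h0 : 0 ≤ η) (h1 : η ≤ 1 / 4) (r : ℕ → Fin n) (t : ℕ)
    (C : Cache n k) : 0 ≤ mwLaw τ η r t C :=
  div_nonneg (mwWeight_pos τ h0 h1 r t C).le
    (Finset.sum_nonneg fun C _ => (mwWeight_pos τ h0 h1 r t C).le)

lemma mwLaw_sum [Nonempty (Cache n k)] (τ : ℕ) {η : ℝ} (h0 : 0 ≤ η) (h1 : η ≤ 1 / 4)
    (r : ℕ → Fin n) (t : ℕ) : ∑ C : Cache n k, mwLaw τ η r t C = 1 := by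
  unfold mwLaw
  rw [← Finset.sum_div]
  exact div_self (Finset.sum_pos (fun C _ => mwWeight_pos τ h0 h1 r t C)
    Finset.univ_nonempty).ne'

/-- Weights only decrease inside a block, so the normalizer does too; keeping the old normalizer
underestimates the new probability. This bounds movement by the loss itself. -/
lemma mwLaw_sub_le [Nonempty (Cache n k)] {τ : ℕ} {η : ℝ} (h0 : 0 ≤ η) (h1 : η ≤ 1 / 4)
    (r : ℕ → Fin n) {t : ℕ} (ht : ¬ τ ∣ t) (C : Cache n k) :
    max (mwLaw τ η r t C - mwLaw τ η r (t + 1) C) 0 ≤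
      η * (mwLaw τ η r t C * missLoss (r t) C) := by
  have hl := missLoss_nonneg (r t) C
  have hp := mwLaw_nonneg τ h0 h1 r t C
  refine max_le ?_ (by positivity)
  have hw : ∀ C : Cache n k, mwWeight τ η r (t + 1) C =
      mwWeight τ η r t C * (1 - η * missLoss (r t) C) := fun C => by simp [mwWeight, ht]
  have hpos := fun t (C : Cache n k) => mwWeight_pos τ h0 h1 r t C
  have hW : ∀ t, 0 < ∑ C : Cache n k, mwWeight τ η r t C := fun t =>
    Finset.sum_pos (fun C _ => hpos t C) Finset.univ_nonempty
  have hle : ∑ C : Cache n k, mwWeight τ η r (t + 1) C ≤ ∑ C : Cache n k, mwWeight τ η r t C := by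
    refine Finset.sum_le_sum fun C _ => ?_
    rw [hw]
    have := missLoss_nonneg (r t) C
    exact mul_le_of_le_one_right (hpos t C).le (by nlinarith)
  have h2 : mwWeight τ η r (t + 1) C / ∑ C : Cache n k, mwWeight τ η r t C ≤ mwLaw τ η r (t + 1) C :=
    div_le_div_of_nonneg_left (hpos _ C).le (hW _) hle
  have h3 : mwWeight τ η r (t + 1) C / ∑ C : Cache n k, mwWeight τ η r t C =
      mwLaw τ η r t C - η * (mwLaw τ η r t C * missLoss (r t) C) := by
    rw [hw, mwLaw]; ring
  linarith

lemma exists_mw [NeZero n] [Nonempty (Cache n k)] {τ : ℕ} (hτ : 1 ≤ τ) {η : ℝ} (h0 : 0 < η)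
    (h1 : k * η ≤ 1 / 4) (hk : 1 ≤ k) :
    ∃ B : Algorithm n k, ∀ (r : ℕ → Fin n) (s : ℕ) (C : Cache n k),
      ∑ t ∈ Finset.Ioc (s * τ) (s * τ + τ), B.stepCost r t ≤
        ∑ t ∈ Finset.Ioc (s * τ) (s * τ + τ), missLoss (r t) C +
        2 * Real.log (Fintype.card (Cache n k)) / η + 8 * k * η * τ + k := by
  have hk' : (1 : ℝ) ≤ k := by exact_mod_cast hk
  have hη : η ≤ 1 / 4 := by nlinarith
  have hna : Nonanticipating (mwLaw (n := n) (k := k) τ η) := by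
    intro r r' t h
    funext C
    simp only [mwLaw]
    rw [mwWeight_nonanticipating τ η r r' t h]
  obtain ⟨B, hB⟩ := exists_algorithm_of_laws hna (fun r t C => mwLaw_nonneg τ h0.le hη r t C)
    (fun r t => mwLaw_sum τ h0.le hη r t)
  refine ⟨B, fun r s C => ?_⟩
  set q : ℕ → ℝ := fun t => ∑ C : Cache n k, mwLaw τ η r t C * missLoss (r t) C with hq
  have hq0 : ∀ t, 0 ≤ q t := fun t => Finset.sum_nonneg fun C _ =>
    mul_nonneg (mwLaw_nonneg τ h0.le hη r t C) (missLoss_nonneg _ _)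
  have hstep : ∀ t, ¬ τ ∣ t → B.stepCost r t ≤ (1 + k * η) * q t := by
    intro t ht
    refine (hB r t).trans ?_
    have : ∑ C : Cache n k, max (mwLaw τ η r t C - mwLaw τ η r (t + 1) C) 0 ≤ η * q t := by
      rw [hq, Finset.mul_sum]
      exact Finset.sum_le_sum fun C _ => mwLaw_sub_le h0.le hη r ht C
    have := mul_le_mul_of_nonneg_left this (Nat.cast_nonneg k : (0 : ℝ) ≤ k)
    change q t + _ ≤ _
    linarith
  have hstep' : ∀ t, B.stepCost r t ≤ q t + k := by
    intro t
    refine (hB r t).trans ?_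
    have : ∑ C : Cache n k, max (mwLaw τ η r t C - mwLaw τ η r (t + 1) C) 0 ≤ 1 := by
      rw [← mwLaw_sum (k := k) τ h0.le hη r t]
      refine Finset.sum_le_sum fun C _ => max_le ?_ (mwLaw_nonneg τ h0.le hη r t C)
      linarith [mwLaw_nonneg τ h0.le hη r (t + 1) C]
    have := mul_le_mul_of_nonneg_left this (Nat.cast_nonneg k : (0 : ℝ) ≤ k)
    change q t + _ ≤ _
    linarith
  -- Only the last step of the block meets a restart, which may move the whole law and costs at most
  -- `k`.
  have hsum : ∑ t ∈ Finset.Ioc (s * τ) (s * τ + τ), B.stepCost r t ≤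
      (1 + k * η) * ∑ t ∈ Finset.Ioc (s * τ) (s * τ + τ), q t + k := by
    obtain ⟨j, rfl⟩ : ∃ j, τ = j + 1 := ⟨τ - 1, by omega⟩
    rw [← add_assoc, Finset.sum_Ioc_succ_top (by omega), Finset.sum_Ioc_succ_top (by omega),
      mul_add _ _ (q _), Finset.mul_sum]
    have h2 : ∑ t ∈ Finset.Ioc (s * (j + 1)) (s * (j + 1) + j), B.stepCost r t ≤
        ∑ t ∈ Finset.Ioc (s * (j + 1)) (s * (j + 1) + j), (1 + k * η) * q t := by
      refine Finset.sum_le_sum fun t ht => hstep t ?_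
      rw [Finset.mem_Ioc] at ht
      rintro ⟨c, rfl⟩
      have h3 : s < c := by
        by_contra h
        nlinarith [Nat.mul_le_mul_right (j + 1) (not_lt.1 h)]
      nlinarith [Nat.mul_le_mul_right (j + 1) (Nat.succ_le_of_lt h3)]
    have h3 := hstep' (s * (j + 1) + j + 1)
    have h4 := hq0 (s * (j + 1) + j + 1)
    have : 0 ≤ k * η * q (s * (j + 1) + j + 1) := by positivity
    linarith
  obtain ⟨V, -, hV1, hV2⟩ := mw_potential (k := k) h0.le hη r s τ le_rfl
  set N : ℝ := (Fintype.card (Cache n k) : ℝ) with hN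
  have hN0 : 0 < N := by rw [hN]; exact_mod_cast Fintype.card_pos
  set Q := ∑ t ∈ Finset.Ioc (s * τ) (s * τ + τ), q t with hQ
  set Λ := ∑ t ∈ Finset.Ioc (s * τ) (s * τ + τ), missLoss (r t) C with hΛ
  have hΛ0 : 0 ≤ Λ := Finset.sum_nonneg fun t _ => missLoss_nonneg _ _
  have hΛ2 : Λ ≤ 2 * τ := by
    have := Finset.sum_le_sum fun t (_ : t ∈ Finset.Ioc (s * τ) (s * τ + τ)) =>
      missLoss_le (r t) C
    simp at this
    linarith
  have hVpos : ∀ C, 0 ≤ V C := fun C => (Real.exp_pos _).le.trans (hV2 C)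
  have hmain : Real.exp (-(η * (1 + 2 * η) * Λ)) ≤ N * Real.exp (-(η * Q)) :=
    (hV2 C).trans ((Finset.single_le_sum (fun C _ => hVpos C) (Finset.mem_univ C)).trans hV1)
  have hlog : -(η * (1 + 2 * η) * Λ) ≤ Real.log N - η * Q := by
    have := Real.log_le_log (Real.exp_pos _) hmain
    rwa [Real.log_exp, Real.log_mul hN0.ne' (Real.exp_pos _).ne', Real.log_exp,
      ← sub_eq_add_neg] at this
  have hQle : Q ≤ Real.log N / η + (1 + 2 * η) * Λ := by
    have : η * Q ≤ η * (Real.log N / η + (1 + 2 * η) * Λ) := by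
      rw [mul_add, mul_div_cancel₀ _ h0.ne']
      linarith
    exact le_of_mul_le_mul_left this h0
  have hlogN : 0 ≤ Real.log N / η :=
    div_nonneg (Real.log_nonneg (by rw [hN]; exact_mod_cast Fintype.card_pos)) h0.le
  refine hsum.trans ?_
  have hkη : 0 ≤ k * η := by positivity
  have h4 : (1 + k * η) * Q ≤ (1 + k * η) * (Real.log N / η + (1 + 2 * η) * Λ) :=
    mul_le_mul_of_nonneg_left hQle (by positivity)
  have h5 : k * η * (Real.log N / η) ≤ 1 * (Real.log N / η) :=
    mul_le_mul_of_nonneg_right (by linarith) hlogN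
  have h6 : k * η + 2 * η + 2 * (k * η) * η ≤ 4 * (k * η) := by nlinarith
  have h7 : (k * η + 2 * η + 2 * (k * η) * η) * Λ ≤ 4 * (k * η) * (2 * τ) :=
    mul_le_mul h6 hΛ2 hΛ0 (by positivity)
  have h8 : 2 * Real.log N / η = Real.log N / η + Real.log N / η := by ring
  rw [h8]
  nlinarith


lemma exists_block_expert [NeZero n] [Nonempty (Cache n k)] (hk : 1 ≤ k)
    (hN : 2 ≤ Fintype.card (Cache n k)) {τ : ℕ} (hτ : 1 ≤ τ) :
    ∃ B : Algorithm n k, ∀ (r : ℕ → Fin n) (s : ℕ) (C : Cache n k),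
      ∑ t ∈ Finset.Ioc (s * τ) (s * τ + τ), B.stepCost r t ≤
        ∑ t ∈ Finset.Ioc (s * τ) (s * τ + τ), missLoss (r t) C +
        10 * √(k * τ * Real.log (Fintype.card (Cache n k))) + k := by
  set L := Real.log (Fintype.card (Cache n k)) with hL
  have hL0 : 0 < L := Real.log_pos (by exact_mod_cast hN)
  have hk' : (1 : ℝ) ≤ k := by exact_mod_cast hk
  have hτ' : (1 : ℝ) ≤ τ := by exact_mod_cast hτ
  -- The condition says exactly that the balanced rate `√(L / (k * τ))` satisfies `k * η ≤ 1 / 4`;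
  -- on shorter blocks a constant cache suffices, since its loss `2 * τ` is at most `8 * √(k * τ *
  -- L)`.
  rcases le_or_gt (16 * k * L) τ with h | h
  · set η := √(L / (k * τ)) with hη
    have hη0 : 0 < η := Real.sqrt_pos.2 (by positivity)
    have hη2 : η ^ 2 = L / (k * τ) := Real.sq_sqrt (by positivity)
    have hkη : k * η ≤ 1 / 4 := by
      refine (le_abs_self _).trans (abs_le_of_sq_le_sq ?_ (by norm_num))
      rw [mul_pow, hη2, mul_div_assoc', div_le_iff₀ (by positivity)]
      nlinarith
    have hηk : η * (k * τ) = √(k * τ * L) := by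
      rw [eq_comm, Real.sqrt_eq_iff_mul_self_eq_of_pos (by positivity)]
      have : η * (k * τ) * (η * (k * τ)) = η ^ 2 * (k * τ) ^ 2 := by ring
      rw [this, hη2]
      field_simp
    have hLη : L / η = η * (k * τ) := by
      rw [div_eq_iff hη0.ne', show η * (k * τ) * η = η ^ 2 * (k * τ) by ring, hη2]
      field_simp
    obtain ⟨B, hB⟩ := exists_mw (n := n) hτ hη0 hkη hk
    refine ⟨B, fun r s C => (hB r s C).trans ?_⟩
    rw [← hL, mul_div_assoc, hLη, ← hηk]
    linarith
  · obtain ⟨B, hB⟩ := exists_algorithm_of_laws (n := n) (k := k)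
      (p := fun _ _ => Pi.single (Classical.arbitrary _) 1) (fun _ _ _ _ => rfl)
      (fun _ _ C => by by_cases hC : C = Classical.arbitrary _ <;> simp [hC])
      (fun _ _ => by simp)
    refine ⟨B, fun r s C => ?_⟩
    have h1 : ∑ t ∈ Finset.Ioc (s * τ) (s * τ + τ), B.stepCost r t ≤
        ∑ t ∈ Finset.Ioc (s * τ) (s * τ + τ), 2 := by
      refine Finset.sum_le_sum fun t _ => (hB r t).trans ?_
      simp [Pi.single_apply, missLoss_le]
    have h2 : 0 ≤ ∑ t ∈ Finset.Ioc (s * τ) (s * τ + τ), missLoss (r t) C :=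
      Finset.sum_nonneg fun _ _ => missLoss_nonneg _ _
    have h3 : (τ : ℝ) ≤ 4 * √(k * τ * L) := by
      rw [← div_le_iff₀' (by norm_num)]
      refine Real.le_sqrt_of_sq_le ?_
      nlinarith
    simp at h1
    have h4 : 0 ≤ √(k * τ * L) := Real.sqrt_nonneg _
    linarith

/-! ### Combining a default expert with a restarted one. -/

/-- The probability assigned to an expert whose weight is `v`, relative to a default expert of
weight one. -/
noncomputable def share (v : ℝ) : ℝ := v / (1 + v)

lemma share_nonneg {v : ℝ} (hv : 0 ≤ v) : 0 ≤ share v := by unfold share; positivity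

lemma share_le_one {v : ℝ} (hv : 0 ≤ v) : share v ≤ 1 :=
  (div_le_one (by linarith)).2 (by linarith)

lemma share_le_self {v : ℝ} (hv : 0 ≤ v) : share v ≤ v :=
  div_le_self hv (by linarith)

lemma share_le_log {v : ℝ} (hv : 0 ≤ v) : share v ≤ Real.log (1 + v) := by
  have := Real.one_sub_inv_le_log_of_pos (show 0 < 1 + v by linarith)
  refine le_trans (le_of_eq ?_) this
  have : 1 + v ≠ 0 := by linarith
  unfold share
  field_simp
  ring

lemma exp_sub_sq_le {x : ℝ} (h : |x| ≤ 1 / 2) : Real.exp (x - x ^ 2) ≤ 1 + x := by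
  rcases le_total 0 x with h0 | h0
  · rw [abs_of_nonneg h0] at h
    have h1 := Real.add_one_le_exp (-(x - x ^ 2))
    rw [Real.exp_neg] at h1
    have h2 : 0 < Real.exp (x - x ^ 2) := Real.exp_pos _
    have h3 : 1 ≤ (1 + x) * (-(x - x ^ 2) + 1) := by nlinarith [pow_nonneg h0 3]
    have h4 : 1 ≤ (1 + x) * (Real.exp (x - x ^ 2))⁻¹ :=
      h3.trans (mul_le_mul_of_nonneg_left h1 (by linarith))
    rwa [← div_eq_mul_inv, one_le_div h2] at h4
  · rw [abs_of_nonpos h0] at h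
    have := exp_neg_le_one_sub (x := -x) (by linarith) h
    convert this using 2 <;> ring

lemma log_one_add_mul_le {v x : ℝ} (hv : 0 ≤ v) (hx : |x| ≤ 1 / 2) :
    Real.log (1 + v * (1 + x)) ≤ Real.log (1 + v) + share v * x := by
  have hx' := abs_le.1 hx
  have h1 : 1 + v * (1 + x) = (1 + v) * (1 + share v * x) := by
    have : 1 + v ≠ 0 := by linarith
    unfold share
    field_simp
    ring
  have h2 : 0 < 1 + share v * x := by
    nlinarith [share_nonneg hv, share_le_one hv]
  rw [h1, Real.log_mul (by linarith) h2.ne']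
  linarith [Real.log_le_sub_one_of_pos h2]

lemma abs_share_mul_sub_le {v x : ℝ} (hv : 0 ≤ v) (hx : |x| ≤ 1 / 2) :
    |share (v * (1 + x)) - share v| ≤ share v * |x| := by
  have hx' := abs_le.1 hx
  have h0 : 0 < 1 + v := by linarith
  have h1 : 1 ≤ 1 + v * (1 + x) := by nlinarith
  have h2 : share (v * (1 + x)) - share v = share v * x / (1 + v * (1 + x)) := by
    have : 1 + v * (1 + x) ≠ 0 := by linarith
    unfold share
    field_simp
    ring
  rw [h2, abs_div, abs_mul, abs_of_nonneg (share_nonneg hv),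
    abs_of_pos (by linarith : 0 < 1 + v * (1 + x))]
  exact div_le_self (mul_nonneg (share_nonneg hv) (abs_nonneg _)) h1

/-- The weight of an expert with gains `d`, relative to a default expert; it is reset to `Z` after
every `τ` steps. -/
noncomputable def prodWeight (τ : ℕ) (η Z : ℝ) (d : ℕ → ℝ) : ℕ → ℝ
  | 0 => Z
  | t + 1 => if τ ∣ t then Z else prodWeight τ η Z d t * (1 + η * (d t - 2 * η))

section Prod

variable {τ : ℕ} {η Z : ℝ} {d : ℕ → ℝ}

lemma abs_eta_mul_le (h0 : 0 < η) (h1 : η ≤ 1 / 4) {x : ℝ} (hx : |x| ≤ 1) :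
    |η * (x - 2 * η)| ≤ 2 * η ∧ |η * (x - 2 * η)| ≤ 1 / 2 := by
  have hx' := abs_le.1 hx
  have : |η * (x - 2 * η)| ≤ 2 * η := by
    rw [abs_le]; constructor <;> nlinarith
  exact ⟨this, this.trans (by linarith)⟩

lemma prodWeight_pos (h0 : 0 < η) (h1 : η ≤ 1 / 4) (hZ : 0 < Z) (hd : ∀ t, |d t| ≤ 1) (t : ℕ) :
    0 < prodWeight τ η Z d t := by
  induction t with
  | zero => exact hZ
  | succ t ih =>
    simp only [prodWeight]
    split_ifs
    · exact hZ
    · have := abs_le.1 (abs_eta_mul_le h0 h1 (hd t)).2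
      exact mul_pos ih (by linarith)

/-- The potential is `log (1 + v) / η`. The drift `-2 * η` in the update pays for switching: the
share moves by at most `2 * η * share v`. -/
lemma prod_virtual_gain (h0 : 0 < η) (h1 : η ≤ 1 / 4) {v x : ℝ} (hv : 0 ≤ v) (hx : |x| ≤ 1) :
    Real.log (1 + v * (1 + η * (x - 2 * η))) / η - Real.log (1 + v) / η ≤
      share v * x - |share (v * (1 + η * (x - 2 * η))) - share v| := by
  obtain ⟨h2, h3⟩ := abs_eta_mul_le h0 h1 hx
  have h4 := log_one_add_mul_le hv h3
  have h5 := (abs_share_mul_sub_le hv h3).trans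
    (mul_le_mul_of_nonneg_left h2 (share_nonneg hv))
  rw [← sub_div, div_le_iff₀ h0]
  nlinarith

/-- At a restart the potential built up so far is given up; since `share v' ≤ log (1 + v') / η`, it
pays for returning the mass to the default expert. Only terms of order `Z` remain. -/
lemma prod_gain (h0 : 0 < η) (h1 : η ≤ 1 / 4) (hZ : 0 < Z) (hd : ∀ t, |d t| ≤ 1) (t : ℕ) :
    Real.log (1 + prodWeight τ η Z d (t + 1)) / η - Real.log (1 + prodWeight τ η Z d t) / η -
        (Z / η + Z) ≤
      share (prodWeight τ η Z d t) * d t -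
        |share (prodWeight τ η Z d (t + 1)) - share (prodWeight τ η Z d t)| := by
  have hv := prodWeight_pos (τ := τ) h0 h1 hZ hd t
  have hg := prod_virtual_gain h0 h1 hv.le (hd t)
  have hδ : 0 ≤ Z / η + Z := by positivity
  by_cases h : τ ∣ t
  · simp only [prodWeight, if_pos h]
    set v := prodWeight τ η Z d t
    set v' := v * (1 + η * (d t - 2 * η)) with hv'
    have hv'0 : 0 ≤ v' := by
      have := abs_le.1 (abs_eta_mul_le h0 h1 (hd t)).2
      exact mul_nonneg hv.le (by linarith)
    have h2 : |share Z - share v| ≤ |share v' - share v| + (share v' + share Z) := by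
      have := abs_sub_le (share Z) (share v') (share v)
      have h3 : |share Z - share v'| ≤ share v' + share Z := by
        rw [abs_le]; constructor <;> linarith [share_nonneg hv'0, share_nonneg hZ.le]
      linarith
    have h3 := share_le_self hZ.le
    have h4 : share v' ≤ Real.log (1 + v') / η := by
      refine (share_le_log hv'0).trans (le_div_self ?_ h0 (by linarith))
      exact Real.log_nonneg (by linarith)
    have h5 : Real.log (1 + Z) / η ≤ Z / η :=
      div_le_div_of_nonneg_right
        (by linarith [Real.log_le_sub_one_of_pos (show 0 < 1 + Z by linarith)]) h0.le
    linarith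
  · simp only [prodWeight, if_neg h]
    linarith

lemma log_prodWeight_start_le (h0 : 0 < η) (hZ : 0 < Z) (s : ℕ) :
    Real.log (1 + prodWeight τ η Z d (s * τ + 1)) / η ≤ Z / η := by
  simp only [prodWeight, if_pos (Dvd.intro_left s rfl)]
  exact div_le_div_of_nonneg_right
    (by linarith [Real.log_le_sub_one_of_pos (show 0 < 1 + Z by linarith)]) h0.le

/-- The window may end anywhere but must start right after a restart, where the potential is at most
`Z / η`; telescoping `prod_gain` then loses almost nothing. -/
lemma prod_sum_gain_ge (h0 : 0 < η) (h1 : η ≤ 1 / 4) (hZ : 0 < Z) (hd : ∀ t, |d t| ≤ 1)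
    (s m : ℕ) :
    -((m + 1) * (Z / η + Z)) ≤ ∑ t ∈ Finset.Ioc (s * τ) (s * τ + m),
      (share (prodWeight τ η Z d t) * d t -
        |share (prodWeight τ η Z d (t + 1)) - share (prodWeight τ η Z d t)|) := by
  have key : Real.log (1 + prodWeight τ η Z d (s * τ + m + 1)) / η - Z / η -
      m * (Z / η + Z) ≤ ∑ t ∈ Finset.Ioc (s * τ) (s * τ + m),
      (share (prodWeight τ η Z d t) * d t -
        |share (prodWeight τ η Z d (t + 1)) - share (prodWeight τ η Z d t)|) := by
    induction m with
    | zero =>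
      have := log_prodWeight_start_le (τ := τ) (d := d) h0 hZ s
      simp
      linarith
    | succ m ih =>
      rw [← add_assoc, Finset.sum_Ioc_succ_top (by omega)]
      have := prod_gain (τ := τ) h0 h1 hZ hd (s * τ + m + 1)
      push_cast
      linarith
  have h2 : 0 ≤ Real.log (1 + prodWeight τ η Z d (s * τ + m + 1)) / η :=
    div_nonneg (Real.log_nonneg (by linarith [prodWeight_pos (τ := τ) h0 h1 hZ hd (s * τ + m + 1)]))
      h0.le
  linarith

/-- As in `mw_potential`, `V` ignores the restart at the end of the block. With `x = η * (d - 2 *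
η)`, the bound `1 + x ≥ exp (x - x ^ 2)` costs `2 * η ^ 2` for the drift and at most `4 * η ^ 2` for
the square, hence the `6`. -/
lemma prod_block_potential (h0 : 0 < η) (h1 : η ≤ 1 / 4) (hZ : 0 < Z) (hd : ∀ t, |d t| ≤ 1)
    (s j : ℕ) (hj : j ≤ τ) :
    ∃ V : ℝ, (j < τ → prodWeight τ η Z d (s * τ + j + 1) = V) ∧
      Z * Real.exp (η * ∑ t ∈ Finset.Ioc (s * τ) (s * τ + j), d t - 6 * η ^ 2 * j) ≤ V ∧
      Real.log (1 + V) / η - Z / η ≤ ∑ t ∈ Finset.Ioc (s * τ) (s * τ + j),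
        (share (prodWeight τ η Z d t) * d t -
        |share (prodWeight τ η Z d t * (1 + η * (d t - 2 * η))) -
          share (prodWeight τ η Z d t)|) := by
  induction j with
  | zero =>
    refine ⟨prodWeight τ η Z d (s * τ + 1), fun _ => rfl, ?_, ?_⟩
    · simp [prodWeight]
    · simpa using log_prodWeight_start_le (τ := τ) (d := d) h0 hZ s
  | succ j ih =>
    obtain ⟨V, hV, hV1, hV2⟩ := ih (by omega)
    replace hV := hV (by omega)
    set t := s * τ + j + 1 with ht
    have hVpos : 0 < V := hV ▸ prodWeight_pos h0 h1 hZ hd t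
    refine ⟨V * (1 + η * (d t - 2 * η)), fun hj' => ?_, ?_, ?_⟩
    · have hnd : ¬ τ ∣ t := by
        intro h
        rw [ht, add_assoc, Nat.dvd_add_right (Dvd.intro_left s rfl)] at h
        exact absurd (Nat.le_of_dvd (by omega) h) (by omega)
      rw [show s * τ + (j + 1) + 1 = t + 1 by omega]
      simp only [prodWeight, if_neg hnd, hV]
    · obtain ⟨h2, h3⟩ := abs_eta_mul_le h0 h1 (hd t)
      rw [← add_assoc, Finset.sum_Ioc_succ_top (by omega), ← ht]
      have h4 : η * (∑ t ∈ Finset.Ioc (s * τ) (s * τ + j), d t + d t) - 6 * η ^ 2 * (j + 1 : ℕ) =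
          (η * ∑ t ∈ Finset.Ioc (s * τ) (s * τ + j), d t - 6 * η ^ 2 * j) +
          (η * d t - 6 * η ^ 2) := by push_cast; ring
      rw [h4, Real.exp_add, ← mul_assoc]
      refine mul_le_mul hV1 ?_ (Real.exp_pos _).le hVpos.le
      refine le_trans (Real.exp_le_exp.2 ?_) (exp_sub_sq_le h3)
      have : (η * (d t - 2 * η)) ^ 2 ≤ (2 * η) ^ 2 :=
        sq_le_sq' (by linarith [(abs_le.1 h2).1]) (abs_le.1 h2).2
      nlinarith
    · rw [← add_assoc, Finset.sum_Ioc_succ_top (by omega), ← ht, hV]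
      have := prod_virtual_gain h0 h1 hVpos.le (hd t)
      linarith

/-- The final `-1` covers the restart in the last step, where the share jumps by at most one. -/
lemma prod_block_gain_ge (hτ : 1 ≤ τ) (h0 : 0 < η) (h1 : η ≤ 1 / 4) (hZ : 0 < Z)
    (hd : ∀ t, |d t| ≤ 1) (s : ℕ) :
    ∑ t ∈ Finset.Ioc (s * τ) (s * τ + τ), d t + Real.log Z / η - 6 * η * τ - Z / η - 1 ≤
      ∑ t ∈ Finset.Ioc (s * τ) (s * τ + τ), (share (prodWeight τ η Z d t) * d t -
        |share (prodWeight τ η Z d (t + 1)) - share (prodWeight τ η Z d t)|) := by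
  obtain ⟨V, -, hV1, hV2⟩ := prod_block_potential h0 h1 hZ hd s τ le_rfl
  have hlog : Real.log Z + (η * ∑ t ∈ Finset.Ioc (s * τ) (s * τ + τ), d t - 6 * η ^ 2 * τ) ≤
      Real.log (1 + V) := by
    have h2 := Real.log_le_log (mul_pos hZ (Real.exp_pos _)) (hV1.trans (by linarith : V ≤ 1 + V))
    rwa [Real.log_mul hZ.ne' (Real.exp_pos _).ne', Real.log_exp] at h2
  have hlog' : Real.log Z / η + (∑ t ∈ Finset.Ioc (s * τ) (s * τ + τ), d t - 6 * η * τ) ≤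
      Real.log (1 + V) / η := by
    rw [le_div_iff₀ h0, add_mul, div_mul_cancel₀ _ h0.ne']
    linarith
  have hpos := fun t => (prodWeight_pos (τ := τ) h0 h1 hZ hd t).le
  have hsum : ∑ t ∈ Finset.Ioc (s * τ) (s * τ + τ), (share (prodWeight τ η Z d t) * d t -
        |share (prodWeight τ η Z d t * (1 + η * (d t - 2 * η))) -
          share (prodWeight τ η Z d t)|) - 1 ≤
      ∑ t ∈ Finset.Ioc (s * τ) (s * τ + τ), (share (prodWeight τ η Z d t) * d t -
        |share (prodWeight τ η Z d (t + 1)) - share (prodWeight τ η Z d t)|) := by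
    obtain ⟨j, rfl⟩ : ∃ j, τ = j + 1 := ⟨τ - 1, by omega⟩
    rw [← add_assoc, Finset.sum_Ioc_succ_top (by omega), Finset.sum_Ioc_succ_top (by omega)]
    have h2 : ∀ t ∈ Finset.Ioc (s * (j + 1)) (s * (j + 1) + j), prodWeight (j + 1) η Z d (t + 1) =
        prodWeight (j + 1) η Z d t * (1 + η * (d t - 2 * η)) := by
      intro t ht
      have : ¬ (j + 1) ∣ t := by
        rw [Finset.mem_Ioc] at ht
        rintro ⟨c, rfl⟩
        have h3 : s < c := by
          by_contra h
          nlinarith [Nat.mul_le_mul_right (j + 1) (not_lt.1 h)]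
        nlinarith [Nat.mul_le_mul_right (j + 1) (Nat.succ_le_of_lt h3)]
      simp only [prodWeight, if_neg this]
    rw [Finset.sum_congr rfl fun t ht => by rw [← h2 t ht]]
    have h3 : |share (prodWeight (j + 1) η Z d (s * (j + 1) + j + 1 + 1)) -
        share (prodWeight (j + 1) η Z d (s * (j + 1) + j + 1))| ≤ 1 := by
      rw [abs_le]
      constructor <;> linarith [share_nonneg (hpos (s * (j + 1) + j + 1 + 1)),
        share_le_one (hpos (s * (j + 1) + j + 1 + 1)), share_nonneg (hpos (s * (j + 1) + j + 1)),
        share_le_one (hpos (s * (j + 1) + j + 1))]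
    have h4 := abs_nonneg (share (prodWeight (j + 1) η Z d (s * (j + 1) + j + 1) *
      (1 + η * (d (s * (j + 1) + j + 1) - 2 * η))) -
        share (prodWeight (j + 1) η Z d (s * (j + 1) + j + 1)))
    linarith
  linarith

end Prod

lemma exists_combination [NeZero n] (hk : 1 ≤ k) (A B : Algorithm n k) {τ : ℕ} (hτ : 1 ≤ τ)
    {η Z : ℝ} (h0 : 0 < η) (h1 : η ≤ 1 / 4) (hZ : 0 < Z) :
    ∃ C : Algorithm n k, ∀ (r : ℕ → Fin n) (s : ℕ),
      (∀ m, ∑ t ∈ Finset.Ioc (s * τ) (s * τ + m), C.stepCost r t ≤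
        ∑ t ∈ Finset.Ioc (s * τ) (s * τ + m), A.stepCost r t +
          3 * k * ((m + 1) * (Z / η + Z))) ∧
      ∑ t ∈ Finset.Ioc (s * τ) (s * τ + τ), C.stepCost r t ≤
        ∑ t ∈ Finset.Ioc (s * τ) (s * τ + τ), B.stepCost r t +
          3 * k * (-Real.log Z / η + 6 * η * τ + Z / η + 1) := by
  have hk' : (1 : ℝ) ≤ k := by exact_mod_cast hk
  -- Step costs lie in `[0, 2 + k]`, so `3 * k` scales the gains to `[-1, 1]` and also dominates the
  -- switching cost `k`.
  let d : (ℕ → Fin n) → ℕ → ℝ := fun r t => (A.stepCost r t - B.stepCost r t) / (3 * k)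
  have hd : ∀ r t, |d r t| ≤ 1 := by
    intro r t
    have a1 := A.stepCost_nonneg r t
    have a2 := A.stepCost_le r t
    have b1 := B.stepCost_nonneg r t
    have b2 := B.stepCost_le r t
    rw [abs_div, abs_of_pos (by positivity : (0 : ℝ) < 3 * k), div_le_one (by positivity), abs_le]
    constructor <;> linarith
  have hkd : ∀ r t, 3 * k * d r t = A.stepCost r t - B.stepCost r t := fun r t =>
    mul_div_cancel₀ _ (by positivity)
  let p : (ℕ → Fin n) → ℕ → ℝ := fun r t => share (prodWeight τ η Z (d r) t)
  have hp : Nonanticipating p := by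
    have : Nonanticipating fun r t => prodWeight τ η Z (d r) t := by
      intro r r' t h
      induction t with
      | zero => rfl
      | succ t ih =>
        rcases Nat.eq_zero_or_pos t with rfl | ht
        · simp [prodWeight]
        · have hdt : d r t = d r' t := by
            simp only [d]
            rw [A.stepCost_congr ht h, B.stepCost_congr ht h]
          simp only [prodWeight] at ih ⊢
          rw [ih fun s h1 h2 => h s h1 (by omega), hdt]
    intro r r' t h
    exact congrArg share (this r r' t h)
  have hw := fun r t => (prodWeight_pos (τ := τ) h0 h1 hZ (hd r) t).le
  refine ⟨mix A B p, fun r s => ?_⟩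
  have hstep : ∀ t, (mix A B p).stepCost r t ≤
      A.stepCost r t - 3 * k * (p r t * d r t - |p r (t + 1) - p r t|) := by
    intro t
    refine (stepCost_mix_le A B hp (fun r t => share_nonneg (hw r t))
      (fun r t => share_le_one (hw r t)) r t).trans ?_
    have h2 : 3 * k * (p r t * d r t) = p r t * (A.stepCost r t - B.stepCost r t) := by
      rw [← hkd]; ring
    have h3 : 0 ≤ k * |p r (t + 1) - p r t| := by positivity
    rw [mul_sub, h2]
    linarith
  have hsum : ∀ m, ∑ t ∈ Finset.Ioc (s * τ) (s * τ + m), (mix A B p).stepCost r t ≤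
      ∑ t ∈ Finset.Ioc (s * τ) (s * τ + m), A.stepCost r t - 3 * k *
      ∑ t ∈ Finset.Ioc (s * τ) (s * τ + m), (p r t * d r t - |p r (t + 1) - p r t|) := by
    intro m
    rw [Finset.mul_sum, ← Finset.sum_sub_distrib]
    exact Finset.sum_le_sum fun t _ => hstep t
  refine ⟨fun m => ?_, ?_⟩
  · have h2 := mul_le_mul_of_nonneg_left (prod_sum_gain_ge (τ := τ) h0 h1 hZ (hd r) s m)
      (by positivity : (0 : ℝ) ≤ 3 * k)
    linarith [hsum m]
  · have h2 := mul_le_mul_of_nonneg_left (prod_block_gain_ge hτ h0 h1 hZ (hd r) s)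
      (by positivity : (0 : ℝ) ≤ 3 * k)
    have h3 : 3 * k * ∑ t ∈ Finset.Ioc (s * τ) (s * τ + τ), d r t =
        ∑ t ∈ Finset.Ioc (s * τ) (s * τ + τ), A.stepCost r t -
        ∑ t ∈ Finset.Ioc (s * τ) (s * τ + τ), B.stepCost r t := by
      rw [Finset.mul_sum, ← Finset.sum_sub_distrib]
      exact Finset.sum_congr rfl fun t _ => hkd r t
    have h4 : -Real.log Z / η = -(Real.log Z / η) := neg_div _ _
    rw [h4]
    linarith [hsum τ]


/-! ### The marking algorithm and its fault potential. -/

/-- The number of elements of `U` to which `σ` gives priority over `i`. -/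
def rank (σ : Equiv.Perm (Fin n)) (U : Finset (Fin n)) (i : Fin n) : ℕ :=
  {j ∈ U | σ j < σ i}.card

/-- The `q` elements of `U` with the highest priority. -/
def top (σ : Equiv.Perm (Fin n)) (U : Finset (Fin n)) (q : ℕ) : Finset (Fin n) :=
  {i ∈ U | rank σ U i < q}

lemma rank_lt_rank {σ : Equiv.Perm (Fin n)} {U : Finset (Fin n)} {i j : Fin n} (hi : i ∈ U)
    (h : σ i < σ j) : rank σ U i < rank σ U j := by
  refine Finset.card_lt_card ⟨fun l hl => ?_, fun hsub => ?_⟩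
  · rw [Finset.mem_filter] at hl ⊢
    exact ⟨hl.1, hl.2.trans h⟩
  · have := hsub (Finset.mem_filter.2 ⟨hi, h⟩)
    exact lt_irrefl _ (Finset.mem_filter.1 this).2

lemma rank_injOn (σ : Equiv.Perm (Fin n)) (U : Finset (Fin n)) : Set.InjOn (rank σ U) U := by
  intro i hi j hj h
  by_contra hij
  rcases lt_or_gt_of_ne (fun h => hij (σ.injective h) : σ i ≠ σ j) with h' | h'
  · exact (rank_lt_rank hi h').ne h
  · exact (rank_lt_rank hj h').ne' h

lemma rank_lt_card {σ : Equiv.Perm (Fin n)} {U : Finset (Fin n)} {i : Fin n} (hi : i ∈ U) :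
    rank σ U i < U.card :=
  Finset.card_lt_card ⟨Finset.filter_subset _ _, fun h =>
    lt_irrefl _ (Finset.mem_filter.1 (h hi)).2⟩

lemma card_top (σ : Equiv.Perm (Fin n)) {U : Finset (Fin n)} {q : ℕ} (hq : q ≤ U.card) :
    (top σ U q).card = q := by
  have himg : U.image (rank σ U) = Finset.range U.card := by
    refine Finset.eq_of_subset_of_card_le (fun a ha => ?_) ?_
    · obtain ⟨i, hi, rfl⟩ := Finset.mem_image.1 ha
      exact Finset.mem_range.2 (rank_lt_card hi)
    · rw [Finset.card_image_of_injOn (rank_injOn σ U), Finset.card_range]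
  have h2 : (top σ U q).image (rank σ U) = Finset.range q := by
    ext a
    simp only [top, Finset.mem_image, Finset.mem_filter, Finset.mem_range]
    constructor
    · rintro ⟨i, ⟨-, h⟩, rfl⟩
      exact h
    · intro ha
      obtain ⟨i, hi, rfl⟩ := Finset.mem_image.1 (himg ▸ Finset.mem_range.2 (ha.trans_le hq))
      exact ⟨i, ⟨hi, ha⟩, rfl⟩
  have h3 : Set.InjOn (rank σ U) (top σ U q) :=
    (rank_injOn σ U).mono (Finset.coe_subset.2 (Finset.filter_subset _ _))
  rw [← Finset.card_image_of_injOn h3, h2, Finset.card_range]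

lemma top_subset (σ : Equiv.Perm (Fin n)) (U : Finset (Fin n)) (q : ℕ) : top σ U q ⊆ U :=
  Finset.filter_subset _ _

lemma top_erase_subset (σ : Equiv.Perm (Fin n)) (U : Finset (Fin n)) (q : ℕ) (i : Fin n) :
    top σ (U.erase i) q ⊆ top σ U (q + 1) := by
  intro j hj
  simp only [top, Finset.mem_filter] at hj ⊢
  refine ⟨Finset.mem_of_mem_erase hj.1, ?_⟩
  have h1 : rank σ U j ≤ rank σ (U.erase i) j + 1 := by
    unfold rank
    rw [Finset.filter_erase]
    have := Finset.pred_card_le_card_erase (s := {l ∈ U | σ l < σ j}) (a := i)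
    omega
  omega

lemma rank_mul_swap {U : Finset (Fin n)} {i j : Fin n} (hi : i ∈ U) (hj : j ∈ U)
    (σ : Equiv.Perm (Fin n)) : rank (σ * Equiv.swap i j) U i = rank σ U j := by
  have hU : ∀ l, l ∈ U ↔ Equiv.swap i j l ∈ U := by
    intro l
    rcases eq_or_ne l i with rfl | h1
    · simp [hi, hj]
    rcases eq_or_ne l j with rfl | h2
    · simp [hi, hj]
    rw [Equiv.swap_apply_of_ne_of_ne h1 h2]
  unfold rank
  refine Finset.card_bij (fun l _ => Equiv.swap i j l) (fun l hl => ?_)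
    (fun a _ b _ h => (Equiv.swap i j).injective h) (fun l hl => ?_)
  · simpa [← hU l] using hl
  · refine ⟨Equiv.swap i j l, ?_, by simp⟩
    simpa [← hU l] using hl

/-- Composing with a transposition shows that all elements of `U` are equally likely to be among the
top `q`. -/
lemma sum_perm_mem_top {U : Finset (Fin n)} {q : ℕ} (hq : q ≤ U.card) {i : Fin n} (hi : i ∈ U) :
    (U.card : ℝ) * ∑ σ : Equiv.Perm (Fin n), (if i ∈ top σ U q then (1 : ℝ) else 0) =
      q * n.factorial := by
  have hsymm : ∀ j ∈ U, ∑ σ : Equiv.Perm (Fin n), (if j ∈ top σ U q then (1 : ℝ) else 0) =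
      ∑ σ : Equiv.Perm (Fin n), (if i ∈ top σ U q then (1 : ℝ) else 0) := by
    intro j hj
    rw [← Equiv.sum_comp (Equiv.mulRight (Equiv.swap i j))
      (fun σ => if i ∈ top σ U q then (1 : ℝ) else 0)]
    refine Finset.sum_congr rfl fun σ _ => ?_
    have h : j ∈ top σ U q ↔ i ∈ top (σ * Equiv.swap i j) U q := by
      simp only [top, Finset.mem_filter, hi, hj, true_and, rank_mul_swap hi hj]
    exact if_congr h rfl rfl
  rw [← nsmul_eq_mul, ← Finset.sum_const, ← Finset.sum_congr rfl hsymm, Finset.sum_comm]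
  have : ∀ σ : Equiv.Perm (Fin n), ∑ j ∈ U, (if j ∈ top σ U q then (1 : ℝ) else 0) = q := by
    intro σ
    rw [Finset.sum_boole, Finset.filter_mem_eq_inter,
      Finset.inter_eq_right.2 (top_subset σ U q), card_top σ hq]
  simp [this, Fintype.card_perm, mul_comm]

/-- State of the marking algorithm: the marked pages, and the cache at the end of the previous
phase. -/
abbrev MarkState (n : ℕ) : Type := Finset (Fin n) × Finset (Fin n)

/-- Transition of the marking algorithm: a new phase starts when `k` pages are marked and another
page is requested. -/
def MarkState.next (k : ℕ) (X : MarkState n) (i : Fin n) : MarkState n :=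
  if i ∈ X.1 then X else if X.1.card = k then ({i}, X.1) else (insert i X.1, X.2)

/-- The cost charged to a request: one if the page was requested neither in this phase nor in the
previous one. -/
def MarkState.clean (k : ℕ) (X : MarkState n) (i : Fin n) : ℝ :=
  if i ∈ X.1 then 0 else if X.1.card = k then 1 else if i ∈ X.2 then 0 else 1

/-- The marked pages, together with a random choice of the pages of the previous phase. -/
def MarkState.cacheSet (k : ℕ) (X : MarkState n) (σ : Equiv.Perm (Fin n)) : Finset (Fin n) :=
  X.1 ∪ top σ (X.2 \ X.1) (k - X.1.card)

/-- The invariant of the marking algorithm. -/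
structure MarkState.Valid (k : ℕ) (X : MarkState n) : Prop where
  card_le : X.1.card ≤ k
  card_eq : X.2.card = k

namespace MarkState

lemma Valid.next {X : MarkState n} (h : X.Valid k) (hk : 1 ≤ k) (i : Fin n) :
    (X.next k i).Valid k := by
  obtain ⟨h1, h2⟩ := h
  unfold MarkState.next
  split_ifs with ha hb
  · exact ⟨h1, h2⟩
  · exact ⟨by simpa using hk, hb⟩
  · refine ⟨?_, h2⟩
    rw [Finset.card_insert_of_notMem ha]
    omega

lemma mem_next (X : MarkState n) (i : Fin n) : i ∈ (X.next k i).1 := by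
  unfold MarkState.next
  split_ifs with ha hb <;> simp [ha]

lemma Valid.card_cacheSet {X : MarkState n} (h : X.Valid k) (σ : Equiv.Perm (Fin n)) :
    (X.cacheSet k σ).card = k := by
  obtain ⟨h1, h2⟩ := h
  unfold cacheSet
  have h3 := Finset.le_card_sdiff X.1 X.2
  rw [Finset.card_union_of_disjoint, card_top σ (by omega)]
  · omega
  · exact Finset.disjoint_sdiff.mono_right (top_subset _ _ _)

/-- The priority order never changes: marking a page lowers the number of unmarked slots by one, and
the pages kept remain within the old selection. Thus only the requested page is ever fetched. -/
lemma Valid.cacheSet_next_subset {X : MarkState n} (h : X.Valid k) (i : Fin n)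
    (σ : Equiv.Perm (Fin n)) : (X.next k i).cacheSet k σ ⊆ insert i (X.cacheSet k σ) := by
  unfold MarkState.next cacheSet
  split_ifs with ha hb
  · exact Finset.subset_insert _ _
  · intro j hj
    rcases Finset.mem_union.1 hj with hj | hj
    · simp_all
    · have := Finset.mem_sdiff.1 (top_subset _ _ _ hj)
      simp_all
  · rw [Finset.insert_union, Finset.card_insert_of_notMem ha, Finset.sdiff_insert]
    have h1 := h.card_le
    have h2 := top_erase_subset σ (X.2 \ X.1) (k - (X.1.card + 1)) i
    rw [show k - (X.1.card + 1) + 1 = k - X.1.card by omega] at h2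
    exact Finset.insert_subset_insert _ (Finset.union_subset_union_right h2)

/-- The probability that the requested page is not in the cache. -/
noncomputable def faultProb (k : ℕ) (X : MarkState n) (i : Fin n) : ℝ :=
  (∑ σ : Equiv.Perm (Fin n), if i ∈ X.cacheSet k σ then (0 : ℝ) else 1) / n.factorial

lemma faultProb_nonneg (X : MarkState n) (i : Fin n) : 0 ≤ X.faultProb k i := by
  unfold faultProb
  refine div_nonneg (Finset.sum_nonneg fun σ _ => ?_) (Nat.cast_nonneg _)
  split_ifs <;> norm_num

lemma faultProb_le_one (X : MarkState n) (i : Fin n) : X.faultProb k i ≤ 1 := by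
  unfold faultProb
  refine div_le_one_of_le₀ ?_ (Nat.cast_nonneg _)
  calc _ ≤ ∑ σ : Equiv.Perm (Fin n), (1 : ℝ) :=
        Finset.sum_le_sum fun σ _ => by split_ifs <;> norm_num
    _ = _ := by simp [Fintype.card_perm]

lemma faultProb_of_mem {X : MarkState n} {i : Fin n} (hi : i ∈ X.1) : X.faultProb k i = 0 := by
  simp [faultProb, cacheSet, hi]

lemma Valid.card_sdiff_eq {X : MarkState n} (h : X.Valid k) :
    ((X.2 \ X.1).card : ℝ) = k - X.1.card + (X.1 \ X.2).card := by
  have h1 := Finset.card_sdiff_add_card_inter X.2 X.1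
  have h2 := Finset.card_sdiff_add_card_inter X.1 X.2
  rw [Finset.inter_comm] at h2
  rw [h.card_eq] at h1
  have h1' : ((X.2 \ X.1).card : ℝ) + (X.2 ∩ X.1).card = k := by exact_mod_cast h1
  have h2' : ((X.1 \ X.2).card : ℝ) + (X.2 ∩ X.1).card = X.1.card := by exact_mod_cast h2
  linarith

/-- Let `c` be the number of marked pages outside the previous phase. The stale pages number `k -
X.1.card + c` and `k - X.1.card` of them are cached, uniformly at random, so a given one is missing
with probability `c` over their number. -/
lemma Valid.faultProb_of_stale {X : MarkState n} (h : X.Valid k) {i : Fin n} (hi : i ∉ X.1)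
    (hi' : i ∈ X.2) :
    X.faultProb k i = (X.1 \ X.2).card / (X.2 \ X.1).card := by
  have hmem : i ∈ X.2 \ X.1 := Finset.mem_sdiff.2 ⟨hi', hi⟩
  have hpos : (0 : ℝ) < (X.2 \ X.1).card := by exact_mod_cast Finset.card_pos.2 ⟨i, hmem⟩
  have hle := Finset.le_card_sdiff X.1 X.2
  rw [h.card_eq] at hle
  have h1 := sum_perm_mem_top hle hmem
  have hf : (0 : ℝ) < n.factorial := by exact_mod_cast n.factorial_pos
  have h2 : ∑ σ : Equiv.Perm (Fin n), (if i ∈ X.cacheSet k σ then (0 : ℝ) else 1) =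
      n.factorial - ∑ σ : Equiv.Perm (Fin n),
        (if i ∈ top σ (X.2 \ X.1) (k - X.1.card) then (1 : ℝ) else 0) := by
    have h3 : (n.factorial : ℝ) = ∑ σ : Equiv.Perm (Fin n), (1 : ℝ) := by
      simp [Fintype.card_perm]
    rw [h3, ← Finset.sum_sub_distrib]
    refine Finset.sum_congr rfl fun σ _ => ?_
    by_cases hc : i ∈ top σ (X.2 \ X.1) (k - X.1.card) <;> simp [cacheSet, hi, hc]
  rw [faultProb, h2, div_eq_div_iff hf.ne' hpos.ne', sub_mul, mul_comm (∑ σ, _), h1,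
    h.card_sdiff_eq, Nat.cast_sub h.card_le]
  ring

/-- Bound on the expected number of faults in terms of the number `N` of clean requests. -/
noncomputable def potential (k : ℕ) (X : MarkState n) (N : ℝ) : ℝ :=
  (harmonic k : ℝ) * (N - (X.1 \ X.2).card) +
    (X.1 \ X.2).card * (1 + (harmonic k : ℝ) - (harmonic (X.2 \ X.1).card : ℝ))

lemma one_le_harmonic {s : ℕ} (hs : 1 ≤ s) : (1 : ℝ) ≤ harmonic s := by
  have h : (1 : ℚ) ≤ harmonic s := by
    have : harmonic 1 ≤ harmonic s := by
      unfold harmonic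
      exact Finset.sum_le_sum_of_subset_of_nonneg (Finset.range_mono hs)
        fun i _ _ => by positivity
    simpa [harmonic] using this
  exact_mod_cast h

lemma harmonic_le_harmonic {s t : ℕ} (hs : s ≤ t) : (harmonic s : ℝ) ≤ harmonic t := by
  have : harmonic s ≤ harmonic t := by
    unfold harmonic
    exact Finset.sum_le_sum_of_subset_of_nonneg (Finset.range_mono hs)
      fun i _ _ => by positivity
  exact_mod_cast this

lemma Valid.potential_le {X : MarkState n} (h : X.Valid k) (N : ℝ) :
    X.potential k N ≤ harmonic k * N := by
  unfold potential
  rcases Nat.eq_zero_or_pos (X.1 \ X.2).card with h0 | h0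
  · simp [h0]
  · have h1 := h.card_sdiff_eq
    have h2 : (X.1.card : ℝ) ≤ k := by exact_mod_cast h.card_le
    have h3 : 1 ≤ (X.2 \ X.1).card := by
      have : ((1 : ℕ) : ℝ) ≤ (X.2 \ X.1).card := by
        have : (1 : ℝ) ≤ (X.1 \ X.2).card := by exact_mod_cast h0
        push_cast; linarith
      exact_mod_cast this
    have h4 := mul_nonneg (Nat.cast_nonneg (α := ℝ) (X.1 \ X.2).card)
      (sub_nonneg.2 (one_le_harmonic h3))
    linarith

/-- A stale request lowers the stale count `s` by one, and the potential rises by `c * (H_s -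
H_{s-1}) = c / s`, exactly the fault probability. A clean request within a phase raises it by `1 +
H_k - H_s ≥ 1`. A new phase closes the account at `H_k * N` and opens with one clean page. -/
lemma Valid.faultProb_add_potential_le {X : MarkState n} (h : X.Valid k) (i : Fin n) (N : ℝ) :
    X.faultProb k i + X.potential k N ≤ (X.next k i).potential k (N + X.clean k i) := by
  by_cases ha : i ∈ X.1
  · simp [faultProb_of_mem ha, MarkState.next, clean, ha]
  by_cases hb : X.1.card = k
  · have h1 := h.potential_le N
    have h2 : (X.next k i).potential k (N + X.clean k i) = harmonic k * N + 1 := by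
      have e1 : ({i} : Finset (Fin n)) \ X.1 = {i} := by simp [ha]
      have e2 : X.1 \ {i} = X.1 := by simp [ha]
      simp only [MarkState.next, clean, ha, hb, if_false, if_true, potential, e1, e2,
        Finset.card_singleton]
      push_cast
      ring
    linarith [X.faultProb_le_one (k := k) i]
  by_cases hc : i ∈ X.2
  · rw [h.faultProb_of_stale ha hc]
    have e1 : insert i X.1 \ X.2 = X.1 \ X.2 := Finset.insert_sdiff_of_mem _ hc
    have e2 : (X.2 \ X.1).card = (X.2 \ insert i X.1).card + 1 := by
      rw [Finset.sdiff_insert, Finset.card_erase_add_one (Finset.mem_sdiff.2 ⟨hc, ha⟩)]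
    simp only [MarkState.next, clean, ha, hb, hc, if_false, if_true, potential, e1, e2,
      harmonic_succ]
    push_cast
    apply le_of_eq
    ring
  · have e1 : (insert i X.1 \ X.2).card = (X.1 \ X.2).card + 1 := by
      rw [Finset.insert_sdiff_of_notMem _ hc, Finset.card_insert_of_notMem (by simp [ha])]
    have e2 : X.2 \ insert i X.1 = X.2 \ X.1 := by
      rw [Finset.sdiff_insert, Finset.erase_eq_of_notMem (by simp [hc])]
    have h1 : (harmonic (X.2 \ X.1).card : ℝ) ≤ harmonic k :=
      harmonic_le_harmonic ((Finset.card_le_card Finset.sdiff_subset).trans h.card_eq.le)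
    have h2 := X.faultProb_le_one (k := k) i
    simp only [MarkState.next, clean, ha, hb, hc, if_false, potential, e1, e2]
    push_cast
    linarith

end MarkState

/-! ### Marking against the offline optimum. -/

/-- The state of the marking algorithm after the first `t` requests. -/
def markState (C₀ : Cache n k) (r : ℕ → Fin n) : ℕ → MarkState n
  | 0 => (∅, C₀.1)
  | t + 1 => (markState C₀ r t).next k (r (t + 1))

/-- The number of clean requests among the first `t`. -/
def cleanCount (C₀ : Cache n k) (r : ℕ → Fin n) : ℕ → ℝ
  | 0 => 0
  | t + 1 => cleanCount C₀ r t + (markState C₀ r t).clean k (r (t + 1))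

lemma markState_valid (hk : 1 ≤ k) (C₀ : Cache n k) (r : ℕ → Fin n) (t : ℕ) :
    (markState C₀ r t).Valid k := by
  induction t with
  | zero => exact ⟨by simp [markState], C₀.2⟩
  | succ t ih => exact ih.next hk _

lemma markState_nonanticipating (C₀ : Cache n k) : Nonanticipating (markState C₀) := by
  intro r r' t h
  induction t with
  | zero => rfl
  | succ t ih =>
    simp only [markState]
    rw [ih fun s h1 h2 => h s h1 (by omega), h (t + 1) (by omega) le_rfl]

lemma sum_faultProb_le (hk : 1 ≤ k) (C₀ : Cache n k) (r : ℕ → Fin n) (m : ℕ) :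
    ∑ t ∈ Finset.Ioc 0 m, (markState C₀ r t).faultProb k (r (t + 1)) ≤
      harmonic k * cleanCount C₀ r (m + 1) := by
  have key : ∀ m, ∑ t ∈ Finset.Ioc 0 m, (markState C₀ r t).faultProb k (r (t + 1)) ≤
      (markState C₀ r (m + 1)).potential k (cleanCount C₀ r (m + 1)) := by
    intro m
    induction m with
    | zero =>
      have h1 := (markState_valid hk C₀ r 0).faultProb_add_potential_le (r 1) 0
      have h2 := (markState C₀ r 0).faultProb_nonneg (k := k) (r 1)
      have h3 : (markState C₀ r 0).potential k 0 = 0 := by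
        simp [markState, MarkState.potential]
      simp only [markState, cleanCount] at *
      simp only [Finset.Ioc_self, Finset.sum_empty]
      linarith
    | succ m ih =>
      rw [Finset.sum_Ioc_succ_top (by omega)]
      have h1 := (markState_valid hk C₀ r (m + 1)).faultProb_add_potential_le (r (m + 1 + 1))
        (cleanCount C₀ r (m + 1))
      simp only [markState, cleanCount] at *
      linarith
  exact (key m).trans ((markState_valid hk C₀ r (m + 1)).potential_le _)

lemma MarkState.clean_le_one (X : MarkState n) (i : Fin n) : X.clean k i ≤ 1 := by
  unfold MarkState.clean
  split_ifs <;> norm_num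

/-- A page newly entering the union is either the request, missed by `C'`, or was fetched into `C'`;
both are paid for. -/
lemma card_insert_union_sdiff_le (i : Fin n) (D : Finset (Fin n)) (C C' P : Cache n k) :
    ((insert i D ∪ C'.1) \ P.1).card ≤
      ((D ∪ C.1) \ P.1).card + (missLoss i C' + moveCost C' C) := by
  have h1 : (insert i D ∪ C'.1) \ P.1 ⊆
      ((D ∪ C.1) \ P.1) ∪ (({i} \ C'.1) ∪ (C'.1 \ C.1)) := by
    intro j
    simp only [Finset.mem_sdiff, Finset.mem_union, Finset.mem_insert, Finset.mem_singleton]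
    tauto
  have h2 := (Finset.card_le_card h1).trans ((Finset.card_union_le _ _).trans
    (Nat.add_le_add_left (Finset.card_union_le _ _) _))
  have h3 : ((({i} : Finset (Fin n)) \ C'.1).card : ℝ) ≤ missLoss i C' := by
    unfold missLoss
    split_ifs with h
    · simp [h]
    · rw [Finset.sdiff_eq_self_of_disjoint (by simpa using h)]; norm_num
  have h4 : (((insert i D ∪ C'.1) \ P.1).card : ℝ) ≤ ((D ∪ C.1) \ P.1).card +
      ((({i} : Finset (Fin n)) \ C'.1).card + (C'.1 \ C.1).card) := by exact_mod_cast h2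
  unfold moveCost
  linarith

lemma MarkState.Valid.card_sdiff_le {X : MarkState n} (h : X.Valid k) (C P : Cache n k) :
    ((X.1 \ X.2).card : ℝ) ≤ (((X.2 ∪ X.1) ∪ C.1) \ P.1).card := by
  have h5 : (X.2 ∪ X.1).card = (X.1 \ X.2).card + k := by
    have := Finset.card_sdiff_add_card X.1 X.2
    rw [h.card_eq, Finset.union_comm] at this
    exact this.symm
  have h6 := Finset.le_card_sdiff P.1 (X.2 ∪ X.1)
  have h7 : ((X.2 ∪ X.1) \ P.1).card ≤ (((X.2 ∪ X.1) ∪ C.1) \ P.1).card :=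
    Finset.card_le_card (Finset.sdiff_subset_sdiff Finset.subset_union_left le_rfl)
  rw [P.2] at h6
  exact_mod_cast (by omega : (X.1 \ X.2).card ≤ _)

/-- Two consecutive phases request at least `k` plus the clean pages of the second, so an offline
cache sequence pays at least for the latter during both. Each phase lies in two such pairs, hence
the factor `2`. In the invariant, `P` and `Q` are offline caches at the start of the previous and of
the current phase, while `y` and `x` bound the cost incurred before those starts. -/
lemma cleanCount_le (hk : 1 ≤ k) (C₀ : Cache n k) (r : ℕ → Fin n) (S : ℕ → Cache n k) (t : ℕ) :
    cleanCount C₀ r t ≤ 2 * ∑ s ∈ Finset.range t,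
      (missLoss (r (s + 1)) (S (s + 1)) + moveCost (S (s + 1)) (S s)) + k := by
  set O : ℕ → ℝ := fun t => ∑ s ∈ Finset.range t,
      (missLoss (r (s + 1)) (S (s + 1)) + moveCost (S (s + 1)) (S s)) with hO
  have key : ∃ (x y : ℝ) (P Q : Cache n k),
      cleanCount C₀ r t - ((markState C₀ r t).1 \ (markState C₀ r t).2).card ≤ x + y + k ∧
      ((((markState C₀ r t).2 ∪ (markState C₀ r t).1) ∪ (S t).1) \ P.1).card + y ≤ O t ∧
      (((markState C₀ r t).1 ∪ (S t).1) \ Q.1).card + x ≤ O t := by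
    induction t with
    | zero =>
      -- The value `-k` absorbs that the initial cache `C₀` may be disjoint from `S 0`; it is the
      -- source of the additive `k`.
      refine ⟨0, -k, S 0, S 0, ?_, ?_, ?_⟩
      · simp [cleanCount, markState]
      · have : ((C₀.1 ∪ ∅ ∪ (S 0).1) \ (S 0).1).card ≤ k := by
          refine (Finset.card_le_card (fun j hj => ?_)).trans C₀.2.le
          simp only [Finset.mem_sdiff, Finset.mem_union] at hj
          simpa using (by tauto : j ∈ C₀.1 ∨ j ∈ (∅ : Finset (Fin n)))
        have : (((C₀.1 ∪ ∅ ∪ (S 0).1) \ (S 0).1).card : ℝ) ≤ k := by exact_mod_cast this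
        simp only [markState, hO, Finset.range_zero, Finset.sum_empty]
        linarith
      · simp [markState, hO]
    | succ t ih =>
      obtain ⟨x, y, P, Q, h1, h2, h3⟩ := ih
      have hOs : O (t + 1) = O t + (missLoss (r (t + 1)) (S (t + 1)) +
          moveCost (S (t + 1)) (S t)) := Finset.sum_range_succ _ _
      simp only [cleanCount, markState]
      set X := markState C₀ r t
      set i := r (t + 1)
      have hP := card_insert_union_sdiff_le i (X.2 ∪ X.1) (S t) (S (t + 1)) P
      have hQ := card_insert_union_sdiff_le i X.1 (S t) (S (t + 1)) Q
      by_cases ha : i ∈ X.1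
      · rw [Finset.insert_eq_of_mem (Finset.mem_union_right _ ha)] at hP
        rw [Finset.insert_eq_of_mem ha] at hQ
        simp only [MarkState.next, MarkState.clean, ha, if_true]
        exact ⟨x, y, P, Q, by linarith, by linarith, by linarith⟩
      by_cases hb : X.1.card = k
      · simp only [MarkState.next, MarkState.clean, ha, hb, if_true, if_false]
        -- At a phase change the current phase becomes the previous one, and the clean requests just
        -- completed are charged by replacing `y` with `O t`.
        refine ⟨O t, x, Q, S (t + 1), ?_, ?_, ?_⟩
        · have e1 : ({i} : Finset (Fin n)) \ X.1 = {i} := by simp [ha]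
          have h4 := (markState_valid hk C₀ r t).card_sdiff_le (S t) P
          rw [e1, Finset.card_singleton]
          push_cast
          linarith
        · rw [show X.1 ∪ {i} = insert i X.1 by rw [Finset.union_comm]; rfl]
          linarith
        · have hE := card_insert_union_sdiff_le i ∅ (S (t + 1)) (S (t + 1)) (S (t + 1))
          simp only [Finset.empty_union, Finset.sdiff_self, Finset.card_empty, moveCost_self,
            insert_empty_eq, Nat.cast_zero] at hE
          linarith [moveCost_nonneg (S (t + 1)) (S t)]
      · have hM : X.2 ∪ insert i X.1 = insert i (X.2 ∪ X.1) := Finset.union_insert _ _ _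
        simp only [MarkState.next, MarkState.clean, ha, hb, if_false]
        refine ⟨x, y, P, Q, ?_, ?_, ?_⟩
        · by_cases hc : i ∈ X.2
          · rw [Finset.insert_sdiff_of_mem _ hc]
            simpa [hc] using h1
          · rw [Finset.insert_sdiff_of_notMem _ hc, Finset.card_insert_of_notMem (by simp [ha])]
            simp only [hc, if_false]
            push_cast
            linarith
        · rw [hM]; linarith
        · linarith
  obtain ⟨x, y, P, Q, h1, h2, h3⟩ := key
  have h4 := (markState_valid hk C₀ r t).card_sdiff_le (S t) P
  have h5 := Nat.cast_nonneg (α := ℝ) (((markState C₀ r t).1 ∪ (S t).1) \ Q.1).card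
  change _ ≤ 2 * O t + k
  linarith

/-- Putting `S 1` at time `0` makes the first, uncharged move free. -/
lemma sum_range_eq_cost (r : ℕ → Fin n) (S : ℕ → Cache n k) (T : ℕ) :
    ∑ s ∈ Finset.range T, (missLoss (r (s + 1)) (S (max (s + 1) 1)) +
      moveCost (S (max (s + 1) 1)) (S (max s 1))) = cost r S 0 T := by
  induction T with
  | zero => simp [cost]
  | succ T ih =>
    rw [Finset.sum_range_succ, ih]
    cases T with
    | zero => simp [cost, moveCost_self]
    | succ T =>
      rw [cost_succ_eq, cost_succ_eq, zero_add, zero_add, Finset.sum_Ioc_succ_top (by omega)]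
      simp
      ring

instance : MeasurableSpace (Equiv.Perm (Fin n)) := ⊤

instance : DiscreteMeasurableSpace (Equiv.Perm (Fin n)) := ⟨fun _ => trivial⟩

open Classical in
/-- A set of `k` pages as a cache. -/
noncomputable def toCache (C₀ : Cache n k) (s : Finset (Fin n)) : Cache n k :=
  if h : s.card = k then ⟨s, h⟩ else C₀

lemma toCache_val (C₀ : Cache n k) {s : Finset (Fin n)} (h : s.card = k) :
    (toCache C₀ s).1 = s := by
  simp [toCache, h]

/-- The marking algorithm with a random priority order of the pages. -/
noncomputable def marking [NeZero n] (C₀ : Cache n k) : Algorithm n k where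
  Ω := Equiv.Perm (Fin n)
  μ := (PMF.uniformOfFintype (Equiv.Perm (Fin n))).toMeasure
  act h σ := toCache C₀ ((onList (markState C₀) h).cacheSet k σ)
  measurable_act _ _ := MeasurableSet.of_discrete

/-- Marking always holds the requested page, so it has no miss loss; its move after time `t` is the
fault on request `t + 1`. -/
lemma stepCost_marking_le [NeZero n] (hk : 1 ≤ k) (C₀ : Cache n k) (r : ℕ → Fin n) {t : ℕ}
    (ht : 1 ≤ t) :
    (marking C₀).stepCost r t ≤ (markState C₀ r t).faultProb k (r (t + 1)) := by
  have hrun : ∀ s σ, ((marking C₀).run r σ s).1 = (markState C₀ r s).cacheSet k σ := by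
    intro s σ
    have : (marking C₀).run r σ s = toCache C₀ ((markState C₀ r s).cacheSet k σ) := by
      simp only [Algorithm.run, marking, (markState_nonanticipating C₀).onList_history]
    rw [this, toCache_val _ ((markState_valid hk C₀ r s).card_cacheSet σ)]
  have hmiss : ∀ σ, missLoss (r t) ((marking C₀).run r σ t) = 0 := by
    intro σ
    obtain ⟨u, rfl⟩ : ∃ u, t = u + 1 := ⟨t - 1, by omega⟩
    rw [missLoss, if_pos]
    rw [hrun]
    exact Finset.mem_union_left _ (MarkState.mem_next _ _)
  have hmove : ∀ σ, moveCost ((marking C₀).run r σ (t + 1)) ((marking C₀).run r σ t) ≤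
      if r (t + 1) ∈ (markState C₀ r t).cacheSet k σ then (0 : ℝ) else 1 := by
    intro σ
    have hsub := (markState_valid hk C₀ r t).cacheSet_next_subset (r (t + 1)) σ
    unfold moveCost
    rw [hrun, hrun]
    simp only [markState]
    split_ifs with h
    · rw [Finset.insert_eq_of_mem h] at hsub
      simp [Finset.sdiff_eq_empty_iff_subset.2 hsub]
    · have : (((markState C₀ r t).next k (r (t + 1))).cacheSet k σ \
          (markState C₀ r t).cacheSet k σ) ⊆ {r (t + 1)} := by
        intro j hj
        have h1 := Finset.mem_sdiff.1 hj
        have h2 := Finset.mem_insert.1 (hsub h1.1)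
        simpa using h2.resolve_right h1.2
      exact_mod_cast (Finset.card_le_card this).trans (by simp)
  have hint : (marking C₀).stepCost r t = ∫ σ : Equiv.Perm (Fin n),
      moveCost ((marking C₀).run r σ (t + 1)) ((marking C₀).run r σ t)
      ∂(PMF.uniformOfFintype (Equiv.Perm (Fin n))).toMeasure := by
    unfold Algorithm.stepCost
    simp only [hmiss, zero_add]
    rfl
  rw [hint, PMF.integral_eq_sum, MarkState.faultProb, Finset.sum_div]
  refine Finset.sum_le_sum fun σ _ => ?_
  have h1 : ((PMF.uniformOfFintype (Equiv.Perm (Fin n))) σ).toReal = (n.factorial : ℝ)⁻¹ := by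
    simp [Fintype.card_perm]
  rw [h1, smul_eq_mul, div_eq_inv_mul]
  exact mul_le_mul_of_nonneg_left (hmove σ) (by positivity)

/-- The marking algorithm is `2 H_k`-competitive. -/
lemma exists_competitive [NeZero n] [Nonempty (Cache n k)] (hk : 1 ≤ k) :
    ∃ A : Algorithm n k, ∀ (r : ℕ → Fin n) (S : ℕ → Cache n k) (m : ℕ),
      ∑ t ∈ Finset.Ioc 0 m, A.stepCost r t ≤
        2 * (harmonic k : ℝ) * cost r S 0 m + harmonic k * (k + 1) := by
  let C₀ : Cache n k := Classical.arbitrary _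
  refine ⟨marking C₀, fun r S m => ?_⟩
  have h1 : ∑ t ∈ Finset.Ioc 0 m, (marking C₀).stepCost r t ≤
      ∑ t ∈ Finset.Ioc 0 m, (markState C₀ r t).faultProb k (r (t + 1)) :=
    Finset.sum_le_sum fun t ht => stepCost_marking_le hk C₀ r (Finset.mem_Ioc.1 ht).1
  have h2 := cleanCount_le hk C₀ r (fun t => S (max t 1)) m
  rw [sum_range_eq_cost] at h2
  -- The step cost at `m` already sees request `m + 1`, which adds at most one clean request.
  have h3 : cleanCount C₀ r (m + 1) ≤ 2 * cost r S 0 m + k + 1 := by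
    simp only [cleanCount]
    linarith [(markState C₀ r m).clean_le_one (k := k) (r (m + 1))]
  have h4 : (0 : ℝ) ≤ harmonic k := by linarith [MarkState.one_le_harmonic hk]
  have h5 := mul_le_mul_of_nonneg_left h3 h4
  linarith [sum_faultProb_le hk C₀ r m]


/-! ### Dyadic decomposition of intervals. -/

lemma four_sqrt_add_le (j : ℕ) : 4 * √(2 ^ j : ℝ) + √(2 ^ (j + 1) : ℝ) ≤ 4 * √(2 ^ (j + 1) : ℝ) := by
  have h1 : √(2 ^ j : ℝ) ^ 2 = 2 ^ j := Real.sq_sqrt (by positivity)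
  have h2 : √(2 ^ (j + 1) : ℝ) ^ 2 = 2 ^ (j + 1) := Real.sq_sqrt (by positivity)
  have h3 : 4 * √(2 ^ j : ℝ) ≤ 3 * √(2 ^ (j + 1) : ℝ) := by
    refine (le_abs_self _).trans (abs_le_of_sq_le_sq ?_ (by positivity))
    have h4 := pow_pos (two_pos : (0 : ℝ) < 2) j
    rw [mul_pow, mul_pow, h1, h2, pow_succ (2 : ℝ) j]
    linarith
  linarith

section Dyadic

variable {f : ℕ → ℝ} {ρ : ℝ} {T : ℕ}

/-- Starting at a multiple of `2 ^ j`, peel off the block of length `2 ^ j` if it fits and continue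
at half the scale; `four_sqrt_add_le` sums the square roots. -/
lemma sum_Ioc_right_le (hρ : 0 ≤ ρ) (hf : ∀ j s, 2 ^ j ≤ T →
      ∑ t ∈ Finset.Ioc (s * 2 ^ j) (s * 2 ^ j + 2 ^ j), f t ≤ ρ * √(2 ^ j : ℝ))
    (j a m : ℕ) (ha : 2 ^ j ∣ a) (hm : m < 2 ^ (j + 1)) (hT : m ≤ T) :
    ∑ t ∈ Finset.Ioc a (a + m), f t ≤ ρ * (4 * √(2 ^ j : ℝ)) := by
  induction j generalizing a m with
  | zero =>
    have h1 : m = 0 ∨ m = 1 := by omega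
    rcases h1 with rfl | rfl
    · simp [hρ]
    · have := hf 0 a (by simpa using hT)
      simp at this ⊢
      linarith
  | succ j ih =>
    have h4 := mul_le_mul_of_nonneg_left (four_sqrt_add_le j) hρ
    have h5 : 0 ≤ ρ * √(2 ^ (j + 1) : ℝ) := by positivity
    have ha' : 2 ^ j ∣ a := (pow_dvd_pow 2 (Nat.le_succ j)).trans ha
    rcases lt_or_ge m (2 ^ (j + 1)) with h | h
    · have := ih a m ha' h hT
      linarith
    · obtain ⟨s, rfl⟩ := ha
      have h1 := hf (j + 1) s (h.trans hT)
      have h2 := ih (2 ^ (j + 1) * s + 2 ^ (j + 1)) (m - 2 ^ (j + 1))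
        (ha'.add (pow_dvd_pow 2 (Nat.le_succ j))) (by rw [pow_succ] at hm; omega) (by omega)
      rw [mul_comm s] at h1
      rw [← Finset.sum_Ioc_consecutive f (Nat.le_add_right _ (2 ^ (j + 1))) (by omega)]
      rw [show 2 ^ (j + 1) * s + 2 ^ (j + 1) + (m - 2 ^ (j + 1)) = 2 ^ (j + 1) * s + m by omega]
        at h2
      linarith

lemma sum_Ioc_left_le (hρ : 0 ≤ ρ) (hf : ∀ j s, 2 ^ j ≤ T →
      ∑ t ∈ Finset.Ioc (s * 2 ^ j) (s * 2 ^ j + 2 ^ j), f t ≤ ρ * √(2 ^ j : ℝ))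
    (j a m : ℕ) (ha : 2 ^ j ∣ a + m) (hm : m < 2 ^ (j + 1)) (hT : m ≤ T) :
    ∑ t ∈ Finset.Ioc a (a + m), f t ≤ ρ * (4 * √(2 ^ j : ℝ)) := by
  induction j generalizing a m with
  | zero => exact sum_Ioc_right_le hρ hf 0 a m (by simp) hm hT
  | succ j ih =>
    have h4 := mul_le_mul_of_nonneg_left (four_sqrt_add_le j) hρ
    have h5 : 0 ≤ ρ * √(2 ^ (j + 1) : ℝ) := by positivity
    have ha' : 2 ^ j ∣ a + m := (pow_dvd_pow 2 (Nat.le_succ j)).trans ha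
    rcases lt_or_ge m (2 ^ (j + 1)) with h | h
    · have := ih a m ha' h hT
      linarith
    · obtain ⟨s, hs⟩ := ha
      obtain ⟨s, rfl⟩ : ∃ u, s = u + 1 := by
        refine ⟨s - 1, (Nat.succ_pred_eq_of_pos (Nat.pos_of_ne_zero ?_)).symm⟩
        rintro rfl
        have := Nat.pos_of_ne_zero (pow_ne_zero (j + 1) (two_ne_zero : (2 : ℕ) ≠ 0))
        omega
      rw [mul_add, mul_one] at hs
      have h1 := hf (j + 1) s (h.trans hT)
      have h3 : a + (m - 2 ^ (j + 1)) = 2 ^ (j + 1) * s := by omega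
      have h2 := ih a (m - 2 ^ (j + 1))
        (by rw [h3]; exact Dvd.dvd.mul_right (pow_dvd_pow 2 (Nat.le_succ j)) s)
        (by rw [pow_succ] at hm; omega) (by omega)
      rw [mul_comm s] at h1
      rw [h3] at h2
      rw [hs, ← Finset.sum_Ioc_consecutive f (by omega : a ≤ 2 ^ (j + 1) * s) (by omega)]
      linarith

lemma sum_Ioc_le_of_dyadic (hρ : 0 ≤ ρ) (hf : ∀ j s, 2 ^ j ≤ T →
      ∑ t ∈ Finset.Ioc (s * 2 ^ j) (s * 2 ^ j + 2 ^ j), f t ≤ ρ * √(2 ^ j : ℝ))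
    {t₀ m : ℕ} (hm : 1 ≤ m) (hT : m ≤ T) :
    ∑ t ∈ Finset.Ioc t₀ (t₀ + m), f t ≤ 8 * ρ * √m := by
  set j := Nat.log 2 m
  have h1 : 2 ^ j ≤ m := Nat.pow_log_le_self 2 (by omega)
  have h2 : m < 2 ^ (j + 1) := Nat.lt_pow_succ_log_self (by norm_num) m
  have hpos : 0 < 2 ^ j := by positivity
  -- The last multiple of `2 ^ j` up to the right end lies in the interval because `2 ^ j ≤ m`; both
  -- sides are then aligned at `a`.
  set a := 2 ^ j * ((t₀ + m) / 2 ^ j) with ha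
  have h3 := Nat.div_add_mod (t₀ + m) (2 ^ j)
  have h4 := Nat.mod_lt (t₀ + m) hpos
  rw [← ha] at h3
  have hr := sum_Ioc_right_le hρ hf j a (t₀ + m - a) (Dvd.intro _ rfl) (by omega) (by omega)
  have hl := sum_Ioc_left_le hρ hf j t₀ (a - t₀)
    (by rw [show t₀ + (a - t₀) = a by omega]; exact Dvd.intro _ rfl) (by omega) (by omega)
  rw [show a + (t₀ + m - a) = t₀ + m by omega] at hr
  rw [show t₀ + (a - t₀) = a by omega] at hl
  rw [← Finset.sum_Ioc_consecutive f (by omega : t₀ ≤ a) (by omega)]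
  have h5 : √(2 ^ j : ℝ) ≤ √m := Real.sqrt_le_sqrt (by exact_mod_cast h1)
  have h6 := mul_le_mul_of_nonneg_left h5 hρ
  linarith

end Dyadic

/-! ### Chaining the combinations over all scales. -/

/-- The regret bound of the chain of combinations on aligned blocks of length `2 ^ j`. -/
noncomputable def blockRegret (n k T j : ℕ) : ℝ :=
  10 * √(k * 2 ^ j * Real.log (n.choose k)) + 30 * k * √(2 ^ j * Real.log T) + 7 * k

lemma card_cache (n k : ℕ) : Fintype.card (Cache n k) = n.choose k := by
  simp

lemma half_le_log {T : ℕ} (hT : 2 ≤ T) : 1 / 2 ≤ Real.log T := by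
  have h1 : Real.log 2 ≤ Real.log T := Real.log_le_log two_pos (by exact_mod_cast hT)
  linarith [Real.log_two_gt_d9]

lemma exists_improvement [NeZero n] [Nonempty (Cache n k)] (hk : 1 ≤ k) (hN : 2 ≤ n.choose k)
    {T : ℕ} (hT : 2 ≤ T) {j : ℕ} (hj : 2 ^ j ≤ T) (A : Algorithm n k) :
    ∃ X : Algorithm n k, ∀ (r : ℕ → Fin n) (s : ℕ),
      (∀ m ≤ T, ∑ t ∈ Finset.Ioc (s * 2 ^ j) (s * 2 ^ j + m), X.stepCost r t ≤
        ∑ t ∈ Finset.Ioc (s * 2 ^ j) (s * 2 ^ j + m), A.stepCost r t + 12 * k / T ^ 2) ∧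
      ∀ C : Cache n k, ∑ t ∈ Finset.Ioc (s * 2 ^ j) (s * 2 ^ j + 2 ^ j), X.stepCost r t ≤
        ∑ t ∈ Finset.Ioc (s * 2 ^ j) (s * 2 ^ j + 2 ^ j), missLoss (r t) C +
          blockRegret n k T j := by
  set L := Real.log T with hL
  have hL0 : 1 / 2 ≤ L := half_le_log hT
  have hT' : (2 : ℝ) ≤ T := by exact_mod_cast hT
  have hj' : (2 : ℝ) ^ j ≤ T := by exact_mod_cast hj
  have hk' : (1 : ℝ) ≤ k := by exact_mod_cast hk
  have hpow : (0 : ℝ) < 2 ^ j := by positivity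
  have hr1 : 0 ≤ √(k * 2 ^ j * Real.log (n.choose k)) := Real.sqrt_nonneg _
  rcases le_or_gt (16 * L) (2 ^ j) with h | h
  · set η := √(L / 2 ^ j) with hη
    have hη0 : 0 < η := Real.sqrt_pos.2 (by positivity)
    have hη2 : η ^ 2 = L / 2 ^ j := Real.sq_sqrt (by positivity)
    have hη1 : η ≤ 1 / 4 := by
      refine (le_abs_self _).trans (abs_le_of_sq_le_sq ?_ (by norm_num))
      rw [hη2, div_le_iff₀ hpow]
      linarith
    have hηT : 1 / T ≤ η := by
      refine (le_abs_self _).trans (abs_le_of_sq_le_sq ?_ hη0.le)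
      rw [hη2, div_pow, one_pow, div_le_div_iff₀ (by positivity) hpow]
      nlinarith
    have hηs : η * 2 ^ j = √(2 ^ j * L) := by
      rw [eq_comm, Real.sqrt_eq_iff_mul_self_eq_of_pos (by positivity)]
      have : η * 2 ^ j * (η * 2 ^ j) = η ^ 2 * (2 ^ j) ^ 2 := by ring
      rw [this, hη2]
      field_simp
    have hLη : L / η = η * 2 ^ j := by
      rw [div_eq_iff hη0.ne', show η * 2 ^ j * η = η ^ 2 * 2 ^ j by ring, hη2]
      field_simp
    -- Since `η ≥ 1 / T`, the loss per step is of order `T⁻³`, while `log (1 / Z) = 4 * log T`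
    -- affects the regret only by a constant factor.
    set Z : ℝ := ((T : ℝ) ^ 4)⁻¹ with hZ
    have hZ0 : 0 < Z := by positivity
    have hZη : Z / η ≤ ((T : ℝ) ^ 3)⁻¹ := by
      rw [div_le_iff₀ hη0]
      calc Z = ((T : ℝ) ^ 3)⁻¹ * (1 / T) := by rw [hZ]; field_simp
        _ ≤ _ := mul_le_mul_of_nonneg_left hηT (by positivity)
    have hZ3 : Z ≤ ((T : ℝ) ^ 3)⁻¹ :=
      inv_anti₀ (by positivity) (pow_le_pow_right₀ (by linarith) (by norm_num))
    have hT3 : ((T : ℝ) ^ 3)⁻¹ ≤ 1 := inv_le_one_of_one_le₀ (one_le_pow₀ (by linarith))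
    have hlogZ : Real.log Z = -(4 * L) := by
      rw [hZ, Real.log_inv, Real.log_pow]; push_cast; ring
    obtain ⟨B, hB⟩ := exists_block_expert (n := n) hk (by rwa [card_cache])
      (Nat.one_le_two_pow (n := j))
    obtain ⟨X, hX⟩ := exists_combination hk A B (Nat.one_le_two_pow (n := j)) hη0 hη1 hZ0
    refine ⟨X, fun r s => ⟨fun m hm => ((hX r s).1 m).trans ?_, fun C => ?_⟩⟩
    · have hm' : (m : ℝ) ≤ T := by exact_mod_cast hm
      have h1 : (m + 1) * (Z / η + Z) ≤ (2 * T) * (2 * ((T : ℝ) ^ 3)⁻¹) :=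
        mul_le_mul (by linarith) (by linarith) (by positivity) (by positivity)
      have h2 : 3 * k * ((2 * T) * (2 * ((T : ℝ) ^ 3)⁻¹)) = 12 * k / T ^ 2 := by
        field_simp
        ring
      rw [← h2]
      gcongr
    · have h1 := hB r s C
      have h2 := (hX r s).2
      rw [card_cache] at h1
      rw [hlogZ, show -(-(4 * L)) / η = 4 * (L / η) by ring, hLη] at h2
      push_cast at h1 h2
      rw [show 6 * η * 2 ^ j = 6 * (η * 2 ^ j) by ring, hηs] at h2
      have h3 : k * (Z / η) ≤ k * 1 := mul_le_mul_of_nonneg_left (hZη.trans hT3) (by positivity)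
      unfold blockRegret
      linarith
  · refine ⟨A, fun r s => ⟨fun m _ => ?_, fun C => ?_⟩⟩
    · have : (0 : ℝ) ≤ 12 * k / T ^ 2 := by positivity
      linarith
    · have h1 := Finset.sum_le_sum fun t (_ : t ∈ Finset.Ioc (s * 2 ^ j) (s * 2 ^ j + 2 ^ j)) =>
        A.stepCost_le r t
      have h2 : 0 ≤ ∑ t ∈ Finset.Ioc (s * 2 ^ j) (s * 2 ^ j + 2 ^ j), missLoss (r t) C :=
        Finset.sum_nonneg fun _ _ => missLoss_nonneg _ _
      have h3 : (2 : ℝ) ^ j ≤ 4 * √(2 ^ j * L) := by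
        rw [← div_le_iff₀' (by norm_num)]
        refine Real.le_sqrt_of_sq_le ?_
        nlinarith
      rw [Finset.sum_const, Nat.card_Ioc, Nat.add_sub_cancel_left, nsmul_eq_mul] at h1
      push_cast at h1
      have h4 : (2 : ℝ) ^ j * (2 + k) ≤ 4 * √(2 ^ j * L) * (3 * k) :=
        mul_le_mul h3 (by linarith) (by positivity) (by positivity)
      have h5 : 0 ≤ k * √(2 ^ j * L) := by positivity
      unfold blockRegret
      linarith

/-- Step `i` adds scale `J - i`, so scales go from coarse to fine. -/
lemma exists_chain [NeZero n] [Nonempty (Cache n k)] (hk : 1 ≤ k) (hN : 2 ≤ n.choose k)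
    {T : ℕ} (hT : 2 ≤ T) (A : Algorithm n k) (J : ℕ) (hJ : 2 ^ J ≤ T) (i : ℕ) (hi : i ≤ J + 1) :
    ∃ X : Algorithm n k, ∀ r : ℕ → Fin n,
      (∀ m ≤ T, ∑ t ∈ Finset.Ioc 0 m, X.stepCost r t ≤
        ∑ t ∈ Finset.Ioc 0 m, A.stepCost r t + i * (12 * k / T ^ 2)) ∧
      ∀ j, J < j + i → j ≤ J → ∀ (s : ℕ) (C : Cache n k),
        ∑ t ∈ Finset.Ioc (s * 2 ^ j) (s * 2 ^ j + 2 ^ j), X.stepCost r t ≤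
          ∑ t ∈ Finset.Ioc (s * 2 ^ j) (s * 2 ^ j + 2 ^ j), missLoss (r t) C +
            blockRegret n k T j + i * (12 * k / T ^ 2) := by
  have hε : (0 : ℝ) ≤ 12 * k / T ^ 2 := by positivity
  induction i with
  | zero => exact ⟨A, fun r => ⟨fun m _ => by simp, fun j h1 h2 => by omega⟩⟩
  | succ i ih =>
    obtain ⟨X, hX⟩ := ih (by omega)
    obtain ⟨Y, hY⟩ := exists_improvement hk hN hT (j := J - i)
      ((Nat.pow_le_pow_right two_pos (Nat.sub_le _ _)).trans hJ) X
    refine ⟨Y, fun r => ⟨fun m hm => ?_, fun j hj hjJ s C => ?_⟩⟩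
    · have h1 := (hX r).1 m hm
      have h2 := (hY r 0).1 m hm
      simp only [zero_mul, zero_add] at h2
      push_cast
      linarith
    · rcases lt_or_ge J (j + i) with h | h
      · have h1 := (hX r).2 j h hjJ s C
        -- A block of the coarser scale `j` starts at a boundary of the new scale `J - i`, so the
        -- guarantee against `X` applies to it.
        have h2 := (hY r (s * 2 ^ (j - (J - i)))).1 (2 ^ j)
          ((Nat.pow_le_pow_right two_pos hjJ).trans hJ)
        rw [mul_assoc, ← pow_add, show j - (J - i) + (J - i) = j by omega] at h2
        push_cast
        linarith
      · have hj' : j = J - i := by omega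
        have h2 := (hY r s).2 C
        rw [← hj'] at h2
        have : (0 : ℝ) ≤ (i + 1 : ℕ) * (12 * k / T ^ 2) := by positivity
        linarith

lemma blockRegret_add_le {T : ℕ} (hT : 2 ≤ T) (j : ℕ) :
    blockRegret n k T j + 12 * k ≤
      70 * (k * √(Real.log T) + √(k * Real.log (n.choose k))) * √(2 ^ j : ℝ) := by
  have hL := half_le_log hT
  have h1 : √(k * 2 ^ j * Real.log (n.choose k)) = √(k * Real.log (n.choose k)) * √(2 ^ j : ℝ) := by
    rw [← Real.sqrt_mul' _ (by positivity)]; congr 1; ring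
  have h2 : √(2 ^ j * Real.log T) = √(Real.log T) * √(2 ^ j : ℝ) := by
    rw [← Real.sqrt_mul' _ (by positivity)]; congr 1; ring
  have h3 : 1 / 2 ≤ √(Real.log T) := Real.le_sqrt_of_sq_le (by linarith)
  have h4 : 1 ≤ √(2 ^ j : ℝ) := Real.one_le_sqrt.2 (one_le_pow₀ (by norm_num))
  have h5 : (1 / 2) * 1 ≤ √(Real.log T) * √(2 ^ j : ℝ) :=
    mul_le_mul h3 h4 zero_le_one (Real.sqrt_nonneg _)
  have h6 : k * ((1 / 2) * 1) ≤ k * (√(Real.log T) * √(2 ^ j : ℝ)) :=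
    mul_le_mul_of_nonneg_left h5 (Nat.cast_nonneg k)
  have h7 : 0 ≤ √(k * Real.log (n.choose k)) * √(2 ^ j : ℝ) := by positivity
  unfold blockRegret
  rw [h1, h2]
  linarith

/-- The regret bound of the theorem, up to a constant factor. -/
noncomputable def intervalRegret (n k T m : ℕ) : ℝ :=
  (k : ℝ) * √((m : ℝ) * Real.log (T : ℝ)) +
    √((k : ℝ) * (m : ℝ) * Real.log ((n.choose k : ℝ) * (T : ℝ)))

lemma exists_adaptive [NeZero n] [Nonempty (Cache n k)] (hk : 1 ≤ k) (hN : 2 ≤ n.choose k)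
    {T : ℕ} (hT : 2 ≤ T) (A : Algorithm n k) :
    ∃ X : Algorithm n k,
      (∀ r, ∑ t ∈ Finset.Ioc 0 T, X.stepCost r t ≤
        ∑ t ∈ Finset.Ioc 0 T, A.stepCost r t + 12 * k) ∧
      ∀ t₀ m, 1 ≤ m → t₀ + m ≤ T → X.HasRegretBound t₀ m (600 * intervalRegret n k T m) := by
  set J := Nat.log 2 T
  have hJ : 2 ^ J ≤ T := Nat.pow_log_le_self 2 (by omega)
  obtain ⟨X, hX⟩ := exists_chain hk hN hT A J hJ (J + 1) le_rfl
  have hT' : (2 : ℝ) ≤ T := by exact_mod_cast hT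
  -- There are `J + 1 ≤ 2 ^ J ≤ T` scales, so the accumulated overhead stays bounded independently
  -- of `T`.
  have hJT : ((J + 1 : ℕ) : ℝ) * (12 * k / T ^ 2) ≤ 12 * k := by
    have h1 : ((J + 1 : ℕ) : ℝ) ≤ T := by
      exact_mod_cast (Nat.lt_two_pow_self (n := J)).trans_le hJ
    rw [mul_div_assoc', div_le_iff₀ (by positivity), mul_comm (12 * (k : ℝ))]
    exact mul_le_mul_of_nonneg_right (by nlinarith) (by positivity)
  refine ⟨X, fun r => ?_, fun t₀ m hm hmT r C => ?_⟩
  · linarith [(hX r).1 T le_rfl]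
  set ρ : ℝ := 70 * (k * √(Real.log T) + √(k * Real.log (n.choose k))) with hρ
  have hblock : ∀ j s, 2 ^ j ≤ T → ∑ t ∈ Finset.Ioc (s * 2 ^ j) (s * 2 ^ j + 2 ^ j),
      (X.stepCost r t - missLoss (r t) C) ≤ ρ * √(2 ^ j : ℝ) := by
    intro j s hj
    have hjJ : j ≤ J := Nat.le_log_of_pow_le (by norm_num) hj
    have h1 := (hX r).2 j (by omega) hjJ s C
    have h2 := blockRegret_add_le (n := n) (k := k) hT j
    rw [Finset.sum_sub_distrib]
    linarith
  have h1 := sum_Ioc_le_of_dyadic (t₀ := t₀) (by positivity) hblock hm (by omega)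
  rw [Finset.sum_sub_distrib] at h1
  have h2 : √((m : ℝ) * Real.log T) = √(Real.log T) * √m := by
    rw [mul_comm, Real.sqrt_mul' _ (by positivity)]
  have h3 : √(k * Real.log (n.choose k)) * √m ≤
      √((k : ℝ) * m * Real.log ((n.choose k : ℝ) * T)) := by
    rw [← Real.sqrt_mul' _ (by positivity)]
    refine Real.sqrt_le_sqrt ?_
    have hN0 : (0 : ℝ) < n.choose k := by exact_mod_cast (by omega : 0 < n.choose k)
    have h4 : Real.log (n.choose k) ≤ Real.log ((n.choose k : ℝ) * T) :=
      Real.log_le_log hN0 (le_mul_of_one_le_right hN0.le (by linarith))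
    calc _ = (k : ℝ) * m * Real.log (n.choose k) := by ring
      _ ≤ _ := mul_le_mul_of_nonneg_left h4 (by positivity)
  have h5 := X.expectedCost_le r t₀ m
  have h6 : 0 ≤ k * (√(Real.log T) * √m) := by positivity
  have h7 : 0 ≤ √(k * Real.log (n.choose k)) * √m := by positivity
  have h8 : Finset.Icc (t₀ + 1) (t₀ + m) = Finset.Ioc t₀ (t₀ + m) := by
    ext; simp
  rw [h8, intervalRegret, h2]
  have h9 : 8 * ρ * √m = 560 * (k * (√(Real.log T) * √m)) +
      560 * (√(k * Real.log (n.choose k)) * √m) := by rw [hρ]; ring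
  linarith

/-! ### Degenerate cases and conclusion. -/

lemma hasRegretBound_of_subsingleton [Subsingleton (Cache n k)] (A : Algorithm n k) (t₀ m : ℕ)
    {R : ℝ} (hR : 0 ≤ R) : A.HasRegretBound t₀ m R := by
  intro r C
  have h1 : ∀ t, A.stepCost r t = missLoss (r t) C := by
    intro t
    have : ∀ ω, missLoss (r t) (A.run r ω t) + moveCost (A.run r ω (t + 1)) (A.run r ω t) =
        missLoss (r t) C := by
      intro ω
      rw [Subsingleton.elim (A.run r ω (t + 1)) (A.run r ω t), moveCost_self,
        Subsingleton.elim (A.run r ω t) C, add_zero]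
    unfold Algorithm.stepCost
    simp [this]
  have h2 := A.expectedCost_le r t₀ m
  simp only [h1] at h2
  have h8 : Finset.Icc (t₀ + 1) (t₀ + m) = Finset.Ioc t₀ (t₀ + m) := by
    ext; simp
  rw [h8]
  linarith

lemma expectedCost_one_le (A : Algorithm n k) (r : ℕ → Fin n) (t₀ : ℕ) :
    A.expectedCost r t₀ 1 ≤ 2 := by
  have h : ∀ ω, cost r (A.run r ω) t₀ 1 = missLoss (r (t₀ + 1)) (A.run r ω (t₀ + 1)) := by
    intro ω
    simp [cost]
  unfold Algorithm.expectedCost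
  simp only [h]
  have := integral_mono (A.integrable_act (fun C => missLoss (r (t₀ + 1)) C) (history r (t₀ + 1)))
    (integrable_const 2) fun ω => missLoss_le _ _
  simpa [Algorithm.run] using this

lemma intervalRegret_nonneg (n k T m : ℕ) : 0 ≤ intervalRegret n k T m := by
  unfold intervalRegret; positivity

lemma exists_regret_algorithm [NeZero n] [Nonempty (Cache n k)] (hk : 1 ≤ k) (T : ℕ)
    (A : Algorithm n k) :
    ∃ X : Algorithm n k,
      (∀ r, ∑ t ∈ Finset.Ioc 0 T, X.stepCost r t ≤
        ∑ t ∈ Finset.Ioc 0 T, A.stepCost r t + 12 * k) ∧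
      ∀ t₀ m, 1 ≤ m → t₀ + m ≤ T → X.HasRegretBound t₀ m (600 * intervalRegret n k T m) := by
  have htriv : ∀ r, ∑ t ∈ Finset.Ioc 0 T, A.stepCost r t ≤
      ∑ t ∈ Finset.Ioc 0 T, A.stepCost r t + 12 * k := fun r => by
    have : (0 : ℝ) ≤ 12 * k := by positivity
    linarith
  -- The tuned rates need both logarithms positive. With a single cache there is no regret; with `T
  -- = 1` it is at most `2`, which the term `√(k * log (n.choose k))` covers.
  rcases lt_or_ge (n.choose k) 2 with hN | hN
  · have : Subsingleton (Cache n k) :=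
      Fintype.card_le_one_iff_subsingleton.1 (by rw [card_cache]; omega)
    exact ⟨A, htriv, fun t₀ m _ _ => hasRegretBound_of_subsingleton A t₀ m
      (mul_nonneg (by norm_num) (intervalRegret_nonneg _ _ _ _))⟩
  rcases lt_or_ge T 2 with hT | hT
  · refine ⟨A, htriv, fun t₀ m hm hmT r C => ?_⟩
    obtain rfl : m = 1 := by omega
    obtain rfl : T = 1 := by omega
    have h1 := expectedCost_one_le A r t₀
    have h2 : 0 ≤ ∑ t ∈ Finset.Icc (t₀ + 1) (t₀ + 1), missLoss (r t) C :=
      Finset.sum_nonneg fun _ _ => missLoss_nonneg _ _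
    have h3 : 1 / 2 ≤ intervalRegret n k 1 1 := by
      have hk' : (1 : ℝ) ≤ k := by exact_mod_cast hk
      have h4 := half_le_log hN
      simp only [intervalRegret, Nat.cast_one, Real.log_one, mul_zero, Real.sqrt_zero, mul_one,
        zero_add]
      exact Real.le_sqrt_of_sq_le (by nlinarith)
    linarith
  · exact exists_adaptive hk hN hT A

lemma intervalRegret_le {n k T : ℕ} (hk : 1 ≤ k) (hkn : k ≤ n) (hT : 1 ≤ T) (m : ℕ) :
    intervalRegret n k T m ≤ 2 * (k * √((m : ℝ) * Real.log ((n : ℝ) * T))) := by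
  have hn : (1 : ℝ) ≤ n := by exact_mod_cast hk.trans hkn
  have hT' : (1 : ℝ) ≤ T := by exact_mod_cast hT
  have hk' : (1 : ℝ) ≤ k := by exact_mod_cast hk
  have hN0 : (0 : ℝ) < n.choose k := by exact_mod_cast Nat.choose_pos hkn
  have h1 : √((m : ℝ) * Real.log T) ≤ √((m : ℝ) * Real.log ((n : ℝ) * T)) := by
    refine Real.sqrt_le_sqrt (mul_le_mul_of_nonneg_left ?_ (Nat.cast_nonneg m))
    exact Real.log_le_log (by linarith) (le_mul_of_one_le_left (by linarith) hn)
  have h2 : Real.log ((n.choose k : ℝ) * T) ≤ k * Real.log ((n : ℝ) * T) := by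
    have h3 : (n.choose k : ℝ) ≤ (n : ℝ) ^ k := by exact_mod_cast Nat.choose_le_pow n k
    have h4 : Real.log (n.choose k) ≤ k * Real.log n := by
      rw [← Real.log_pow]; exact Real.log_le_log hN0 h3
    have h5 := mul_le_mul_of_nonneg_right hk' (Real.log_nonneg hT')
    rw [Real.log_mul hN0.ne' (by linarith), Real.log_mul (by linarith) (by linarith), mul_add]
    linarith
  have h3 : √((k : ℝ) * m * Real.log ((n.choose k : ℝ) * T)) ≤
      k * √((m : ℝ) * Real.log ((n : ℝ) * T)) := by
    rw [← Real.sqrt_sq (by linarith : (0 : ℝ) ≤ k), ← Real.sqrt_mul (sq_nonneg _),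
      Real.sqrt_sq (by linarith : (0 : ℝ) ≤ k)]
    refine Real.sqrt_le_sqrt ?_
    calc _ ≤ (k : ℝ) * m * (k * Real.log ((n : ℝ) * T)) :=
          mul_le_mul_of_nonneg_left h2 (by positivity)
      _ = _ := by ring
  unfold intervalRegret
  have := mul_le_mul_of_nonneg_left h1 (Nat.cast_nonneg (α := ℝ) k)
  linarith

end Paging

theorem mainTheorem9 :
    ∃ c : ℝ, 0 < c ∧ ∀ n k : ℕ, 1 ≤ k → k ≤ n →
      ∃ A : ℕ → Paging.Algorithm n k,
        Paging.HasCompetitiveRatio A (2 * (harmonic k : ℝ)) ∧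
        ∀ T : ℕ, 1 ≤ T → ∀ t₀ m : ℕ, 1 ≤ m → t₀ + m ≤ T →
          (A T).HasRegretBound t₀ m
            (c * ((k : ℝ) * √((m : ℝ) * Real.log (T : ℝ)) +
              √((k : ℝ) * (m : ℝ) * Real.log ((n.choose k : ℝ) * (T : ℝ))))) ∧
          (k : ℝ) * √((m : ℝ) * Real.log (T : ℝ)) +
              √((k : ℝ) * (m : ℝ) * Real.log ((n.choose k : ℝ) * (T : ℝ))) ≤
            c * ((k : ℝ) * √((m : ℝ) * Real.log ((n : ℝ) * (T : ℝ)))) := by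
  refine ⟨600, by norm_num, fun n k hk hkn => ?_⟩
  have : NeZero n := ⟨by omega⟩
  have : Nonempty (Cache n k) := by
    rw [← Fintype.card_pos_iff, Paging.card_cache]
    exact Nat.choose_pos hkn
  obtain ⟨B, hB⟩ := Paging.exists_competitive (n := n) hk
  choose A hA hR using fun T => Paging.exists_regret_algorithm hk T B
  have hk' : (1 : ℝ) ≤ k := by exact_mod_cast hk
  refine ⟨A, ⟨harmonic k * (k + 1) + 12 * k, ?_, fun T r S => ?_⟩, fun T hT t₀ m hm hmT =>
    ⟨hR T t₀ m hm hmT, ?_⟩⟩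
  · have := Paging.MarkState.one_le_harmonic hk
    positivity
  · have h1 := (A T).expectedCost_le r 0 T
    rw [zero_add] at h1
    linarith [hA T r, hB r S T]
  · refine (Paging.intervalRegret_le hk hkn hT m).trans ?_
    gcongr
    norm_num
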